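/- Let $\mathbf{Top}$ be the category of compactly generated spaces, i.e. spaces whose topology is coinduced by the continuous maps from compact Hausdorff spaces. For a small category $\mathcal C$ and functors $F:\mathcal C^{\mathrm{op}}\to\mathbf{Top}$, $G:\mathcal C\to\mathbf{Top}$, let $F\otimes_{\mathcal C}G=\int^{c}F(c)\times G(c)$ be their coend in $\mathbf{Top}$. *Segal's category.* $\Gamma$ has objects $\underline n=\{1,\dots,n\}$, $n\ge 0$; a morphism $\underline m\to\underline n$ is an $m$-tuple of pairwise disjoint subsets of $\underline n$, and $(N_1,\dots,N_m)\circ(M_1,\dots,M_k)=(\bigcup_{j\in M_1}N_j,\dots,\bigcup_{j\in M_k}N_j)$. A $\Gamma$-space is a functor $A:\Gamma^{\mathrm{op}}\to\mathbf{Top}$ such that $A(\underline 0)$ is a one-point space. A based space $(X,*)$ defines a functor $X^-:\Gamma\to\mathbf{Top}$, $\underline n\mapsto X^n$; a morphism $(M_1,\dots,M_m):\underline m\to\underline n$ acts by $(x_i)\mapsto(y_j)$ with $y_j=x_i$ if $j\in M_i$ and $y_j=*$ if $j\notin\bigcup_i M_i$. Put $\underline A(X)=A\otimes_\Gamma X^-$.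 The $n$-th space of the Segal spectrum of $A$ is $\underline A(S^n)$, where $S^n$ is the based $n$-sphere. Segal's functor $\gamma:\Delta\to\Gamma$ takes $[m]$ to $\underline m$ and $\phi:[k]\to[m]$ to $\gamma(\phi)(i)=\{j\in\underline m\mid\phi(i-1)<j\le\phi(i)\}$, $i=1,\dots,k$. *Wreath products.* For a small category $\mathcal A$, the category $\Gamma\wr\mathcal A$ (resp. $\Delta\wr\mathcal A$) has as objects the tuples $(A_1,\dots,A_m)$, $m\ge 0$, of objects of $\mathcal A$; a morphism $(A_1,\dots,A_m)\to(B_1,\dots,B_n)$ consists of a morphism $\phi:\underline m\to\underline n$ of $\Gamma$ (resp. $\phi:[m]\to[n]$ of $\Delta$) and of morphisms $\phi_i^k:A_i\to B_k$ of $\mathcal A$ for all $i$ and all $k\in\phi(i)$ (resp. $k\in\gamma(\phi)(i)$), with the composition induced by that of $\mathcal A$. Let $\Theta_1=\Delta$ and $\Theta_n=\Delta\wr\Theta_{n-1}$ for $n\ge2$. Let $\alpha:\Gamma\wr\Gamma\to\Gamma$, $(\underline n_1,\dots,\underline n_k)\mapsto\underline{n_1+\dots+n_k}$, be given by disjoint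 sum. The assembly functors $\gamma_n:\Theta_n\to\Gamma$ are $\gamma_1=\gamma$ and, for $n\ge 2$, the composite $\gamma_n:\Delta\wr\Theta_{n-1}\xrightarrow{\gamma\wr\gamma_{n-1}}\Gamma\wr\Gamma\xrightarrow{\alpha}\Gamma$. *Realisation.* Let $\Theta_1^-:\Delta\to\mathbf{Top}$ be the functor $[m]\mapsto\Delta^m$ (standard topological simplex). For $n\ge2$ let $\delta:\Delta\times\Theta_{n-1}\to\Delta\wr\Theta_{n-1}$, $([m],S)\mapsto(S,\dots,S)$ ($m$ entries), be the diagonal functor, and let $\Theta_n^-:\Theta_n\to\mathbf{Top}$ take $T$ to $\delta^*\Theta_n[T]\otimes_{\Delta\times\Theta_{n-1}}(\Delta^-\times\Theta_{n-1}^-)$, where $\Theta_n[T]=\Theta_n(-,T)$ is regarded as a presheaf of discrete spaces. The geometric realisation of $X:\Theta_n^{\mathrm{op}}\to\mathbf{Top}$ is $|X|_{\Theta_n}=X\otimes_{\Theta_n}\Theta_n^-$. **Corollary.** For every $n\ge1$ and every $\Gamma$-space $A$ there is a homeomorphism $$|\gamma_n^*A|_{\Theta_n}\;\cong\;\underline A(S^n),$$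 where $\gamma_n^*A=A\circ\gamma_n^{\mathrm{op}}$, and these homeomorphisms can be chosen to be natural in $A$. -/

import Mathlib

open CategoryTheory Opposite Topology

universe u

namespace ThetaSpaces

/-! ### Compactly generated spaces -/

/-- The family of all compact Hausdorff spaces (of size `u`), used as test spaces. -/
abbrev compHausFamily (K : CompHaus.{u}) : Type u := K.toTop

/-- The category of compactly generated spaces: the full subcategory of topological spaces
whose topology is coinduced by the continuous maps from compact Hausdorff spaces. -/
abbrev CGTop : Type (u + 1) := GeneratedByTopCat.{u} compHausFamily.{u}

/-- Compact generation of the objects of `CGTop` is Mathlib's `UCompactlyGeneratedSpace`. -/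
theorem isGeneratedBy_iff_uCompactlyGeneratedSpace (Y : Type u) [TopologicalSpace Y] :
    IsGeneratedBy compHausFamily.{u} Y ↔ UCompactlyGeneratedSpace.{u} Y := by
  constructor
  · intro h
    refine uCompactlyGeneratedSpace_of_isOpen fun s hs ↦ ?_
    exact (IsGeneratedBy.isOpen_iff (X := compHausFamily.{u})).2 fun K f ↦ hs K f
  · intro h
    refine IsGeneratedBy.iff_le_generatedBy.2 ?_
    intro s hs
    refine UCompactlyGeneratedSpace.isOpen (X := Y) fun K f ↦ ?_
    exact (WithGeneratedByTopology.isOpen_iff (X := compHausFamily.{u})).1 hs f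

/-- The functor replacing the topology of a space by the associated compactly generated one. -/
noncomputable abbrev kify : TopCat.{u} ⥤ CGTop.{u} :=
  TopCat.toGeneratedByTopCat (X := compHausFamily.{u})

/-- The binary product of compactly generated spaces. -/
noncomputable def kProd : CGTop.{u} × CGTop.{u} ⥤ CGTop.{u} where
  obj P := kify.obj (TopCat.of (P.1 × P.2))
  map f := kify.map (TopCat.ofHom
    ⟨Prod.map f.1.hom f.2.hom, f.1.hom.hom.continuous.prodMap f.2.hom.hom.continuous⟩)

/-- A set, regarded as a discrete space. -/
noncomputable def discreteSpace : Type ⥤ CGTop.{u} :=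
  uliftFunctor.{u, 0} ⋙ TopCat.discrete.{u} ⋙ kify.{u}

/-! ### Tensor products of functors (coends) -/

section Tensor

variable {C : Type} [SmallCategory C]

/-- The identifications `(F(f)x, y) ∼ (x, G(f)y)` defining the tensor product `F ⊗_C G`. -/
inductive TensorRel (F : Cᵒᵖ ⥤ CGTop.{u}) (G : C ⥤ CGTop.{u}) :
    (Σ c : C, kProd.obj (F.obj (op c), G.obj c)) →
      (Σ c : C, kProd.obj (F.obj (op c), G.obj c)) → Prop
  | glue {c d : C} (f : c ⟶ d) (x : F.obj (op d)) (y : G.obj c) :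
      TensorRel F G
        ⟨c, (WithGeneratedByTopology.equiv (X := compHausFamily.{u})).symm ((F.map f.op).hom x, y)⟩
        ⟨d, (WithGeneratedByTopology.equiv (X := compHausFamily.{u})).symm (x, (G.map f).hom y)⟩

/-- The tensor product `F ⊗_C G`, i.e. the coend `∫^c F(c) × G(c)` in compactly generated spaces:
the quotient of the disjoint union of the spaces `F(c) × G(c)` by the equivalence relation
generated by `TensorRel`. -/
noncomputable def tensorObj (F : Cᵒᵖ ⥤ CGTop.{u}) (G : C ⥤ CGTop.{u}) : CGTop.{u} :=
  GeneratedByTopCat.of (Quot (TensorRel F G))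

/-- The map `F ⊗_C G → F' ⊗_C G` induced by a natural transformation `F → F'`. -/
noncomputable def tensorMap {F F' : Cᵒᵖ ⥤ CGTop.{u}} (a : F ⟶ F') (G : C ⥤ CGTop.{u}) :
    tensorObj F G ⟶ tensorObj F' G :=
  ObjectProperty.homMk (TopCat.ofHom
    { toFun := Quot.map
        (Sigma.map id fun c ↦ (kProd.map (X := (F.obj (op c), G.obj c))
          (Y := (F'.obj (op c), G.obj c)) (a.app (op c), 𝟙 (G.obj c))).hom)
        (by
          rintro _ _ ⟨f, x, y⟩
          have h : (a.app (op _)).hom ((F.map f.op).hom x) =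
              (F'.map f.op).hom ((a.app (op _)).hom x) :=
            ConcreteCategory.congr_hom (a.naturality f.op) x
          have := TensorRel.glue (F := F') (G := G) f ((a.app (op _)).hom x) y
          rw [← h] at this
          exact this)
      continuous_toFun := by
        refine continuous_quot_lift _ (continuous_quot_mk.comp ?_)
        exact Continuous.sigma_map fun c ↦ (kProd.map (X := (F.obj (op c), G.obj c))
          (Y := (F'.obj (op c), G.obj c)) (a.app (op c), 𝟙 (G.obj c))).hom.hom.continuous })

/-- The functor `F ↦ F ⊗_C G`. -/
noncomputable def tensor (G : C ⥤ CGTop.{u}) : (Cᵒᵖ ⥤ CGTop.{u}) ⥤ CGTop.{u} where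
  obj F := tensorObj F G
  map a := tensorMap a G
  map_id F := by
    ext x
    obtain ⟨y, rfl⟩ := Quot.exists_rep (r := TensorRel F G) x
    rfl
  map_comp {F F' F''} a b := by
    ext x
    obtain ⟨y, rfl⟩ := Quot.exists_rep (r := TensorRel F G) x
    rfl

end Tensor

/-! ### Segal's category `Γ` -/

/-- The objects `n̲ = {1, …, n}` of `Γ`. -/
structure Gam : Type where
  /-- The number `n` of elements of `n̲`, which is modelled by `Fin n`. -/
  card : ℕ

/-- A `Γ`-operator `m̲ → n̲`: an `m`-tuple of pairwise disjoint subsets of `n̲`. -/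
@[ext]
structure Gam.Hom (m n : Gam) : Type where
  /-- The subsets. -/
  sets : Fin m.card → Set (Fin n.card)
  /-- The subsets are pairwise disjoint. -/
  disj : Pairwise fun i j ↦ Disjoint (sets i) (sets j)

theorem Gam.Hom.eq_of_mem {m n : Gam} (f : Gam.Hom m n) {i j : Fin m.card} {k : Fin n.card}
    (hi : k ∈ f.sets i) (hj : k ∈ f.sets j) : i = j := by
  by_contra h
  exact Set.disjoint_left.1 (f.disj h) hi hj

instance : SmallCategory Gam where
  Hom := Gam.Hom
  id m := ⟨fun i ↦ {i}, fun i j h ↦ by simpa using h⟩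
  comp f g := ⟨fun i ↦ ⋃ j ∈ f.sets i, g.sets j, fun i i' h ↦ by
    refine Set.disjoint_left.2 fun l hl hl' ↦ h ?_
    simp only [Set.mem_iUnion, exists_prop] at hl hl'
    obtain ⟨j, hj, hl⟩ := hl
    obtain ⟨j', hj', hl'⟩ := hl'
    obtain rfl := g.eq_of_mem hl hl'
    exact f.eq_of_mem hj hj'⟩
  id_comp f := by ext; simp
  comp_id f := by ext; simp
  assoc f g h := by
    ext i l
    simp only [Set.mem_iUnion, exists_prop]
    constructor
    · rintro ⟨k, ⟨j, hj, hk⟩, hl⟩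
      exact ⟨j, hj, k, hk, hl⟩
    · rintro ⟨j, hj, k, hk, hl⟩
      exact ⟨k, ⟨j, hj, hk⟩, hl⟩

@[ext]
theorem Gam.hom_ext {m n : Gam} {f g : m ⟶ n} (h : ∀ i, f.sets i = g.sets i) : f = g :=
  Gam.Hom.ext (funext h)

theorem Gam.mem_id {m : Gam} {i k : Fin m.card} :
    k ∈ Gam.Hom.sets (𝟙 m) i ↔ k = i := Iff.rfl

theorem Gam.mem_comp {m n p : Gam} {f : m ⟶ n} {g : n ⟶ p} {i : Fin m.card} {l : Fin p.card} :
    l ∈ Gam.Hom.sets (f ≫ g) i ↔ ∃ j, j ∈ f.sets i ∧ l ∈ g.sets j := by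
  change (l ∈ ⋃ j ∈ f.sets i, g.sets j) ↔ _
  simp

/-- Segal's functor `γ : Δ → Γ`, with `γ([m]) = m̲` and
`γ(φ)(i) = {j | φ(i - 1) < j ≤ φ(i)}` for `i = 1, …, k`. The elements `i` of `k̲` and `j` of `m̲`
are the successors of elements of `Fin k` and `Fin m`. -/
def segal : SimplexCategory ⥤ Gam where
  obj X := ⟨X.len⟩
  map {X Y} φ :=
    { sets := fun i : Fin X.len ↦
        {j : Fin Y.len | φ.toOrderHom i.castSucc < j.succ ∧ j.succ ≤ φ.toOrderHom i.succ}
      disj := by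
        have key : ∀ i i' : Fin X.len, i < i' →
            φ.toOrderHom i.succ ≤ φ.toOrderHom i'.castSucc := fun i i' h ↦
          φ.toOrderHom.monotone (Fin.le_castSucc_iff.2 (Fin.succ_lt_succ_iff.2 h))
        intro i i' h
        refine Set.disjoint_left.2 fun j hj hj' ↦ ?_
        rcases lt_or_gt_of_ne h with h | h
        · exact absurd ((hj.2.trans (key _ _ h)).trans_lt hj'.1) (lt_irrefl _)
        · exact absurd ((hj'.2.trans (key _ _ h)).trans_lt hj.1) (lt_irrefl _) }
  map_id X := by
    refine Gam.hom_ext fun i ↦ ?_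
    ext j
    rw [Gam.mem_id]
    change Fin.castSucc (n := X.len) i < Fin.succ (n := X.len) j ∧
      Fin.succ (n := X.len) j ≤ Fin.succ (n := X.len) i ↔ @Eq (Fin X.len) j i
    rw [Fin.ext_iff]
    simp only [Fin.lt_def, Fin.le_def, Fin.val_castSucc, Fin.val_succ]
    omega
  map_comp {X Y Z} φ ψ := by
    refine Gam.hom_ext fun i ↦ ?_
    ext l
    rw [Gam.mem_comp]
    change ψ.toOrderHom (φ.toOrderHom (Fin.castSucc i)) < Fin.succ l ∧
      Fin.succ l ≤ ψ.toOrderHom (φ.toOrderHom (Fin.succ i)) ↔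
      ∃ j : Fin Y.len, (φ.toOrderHom (Fin.castSucc i) < j.succ ∧
        j.succ ≤ φ.toOrderHom (Fin.succ i)) ∧
        ψ.toOrderHom j.castSucc < Fin.succ l ∧ Fin.succ l ≤ ψ.toOrderHom j.succ
    constructor
    · rintro ⟨h1, h2⟩
      have key : ∀ t : Fin (Y.len + 1), Fin.succ l ≤ ψ.toOrderHom t →
          ∃ j : Fin Y.len, j.succ ≤ t ∧
            (ψ.toOrderHom j.castSucc < Fin.succ l ∧ Fin.succ l ≤ ψ.toOrderHom j.succ) ∧
            φ.toOrderHom (Fin.castSucc i) < j.succ := by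
        intro t
        induction t using Fin.induction with
        | zero =>
          intro ht
          exact absurd (h1.trans_le (ht.trans (ψ.toOrderHom.monotone (Fin.zero_le _))))
            (lt_irrefl _)
        | succ t ih =>
          intro ht
          by_cases h : Fin.succ l ≤ ψ.toOrderHom t.castSucc
          · obtain ⟨j, hj, hj'⟩ := ih h
            exact ⟨j, hj.trans (Fin.castSucc_lt_succ).le, hj'⟩
          · refine ⟨t, le_rfl, ⟨lt_of_not_ge h, ht⟩, ?_⟩
            by_contra h3
            exact absurd (h1.trans_le (ht.trans (ψ.toOrderHom.monotone (not_lt.1 h3))))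
              (lt_irrefl _)
      obtain ⟨j, hj, hj', hj''⟩ := key _ h2
      exact ⟨j, ⟨hj'', hj⟩, hj'⟩
    · rintro ⟨j, ⟨h1, h2⟩, h3, h4⟩
      refine ⟨lt_of_le_of_lt (ψ.toOrderHom.monotone ?_) h3,
        h4.trans (ψ.toOrderHom.monotone h2)⟩
      exact Fin.le_castSucc_iff.2 h1

/-! ### Wreath products -/

section Wreath

variable {B : Type} [SmallCategory B]

/-- The objects of the wreath product `B ≀ A` over a functor `G : B → Γ`: an object `b` of `B`
together with a tuple of objects of `A` indexed by the elements of `G(b)`. For `G = γ : Δ → Γ` this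
is `Δ ≀ A`, for `G = id_Γ` it is `Γ ≀ A`; in both cases the objects are the tuples
`(A_1, …, A_m)`, `m ≥ 0`. -/
structure Wreath (G : B ⥤ Gam) (A : Type) : Type where
  /-- The object of `B`. -/
  base : B
  /-- The tuple of objects of `A`. -/
  label : Fin (G.obj base).card → A

variable {G : B ⥤ Gam} {A : Type} [SmallCategory A]

/-- The operators `(φ; φ_1, …, φ_m) : (A_1, …, A_m) → (B_1, …, B_n)` of the wreath product: a
morphism `φ` of `B` and, for each `i`, a morphism `A[A_i] → ∏_{k ∈ G(φ)(i)} A[B_k]`, given by its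
components `A_i → B_k`. -/
structure Wreath.Hom (X Y : Wreath G A) : Type where
  /-- The morphism of `B`. -/
  base : X.base ⟶ Y.base
  /-- The components. -/
  label : ∀ i k, k ∈ (G.map base).sets i → (X.label i ⟶ Y.label k)

theorem Wreath.Hom.ext' {X Y : Wreath G A} {f g : Wreath.Hom X Y} (hb : f.base = g.base)
    (hl : ∀ i k (h : k ∈ (G.map f.base).sets i) (h' : k ∈ (G.map g.base).sets i),
      f.label i k h = g.label i k h') : f = g := by
  obtain ⟨fb, fl⟩ := f
  obtain ⟨gb, gl⟩ := g
  obtain rfl : fb = gb := hb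
  congr
  funext i k h
  exact hl i k h h

theorem Wreath.exists_mem {X Y Z : Wreath G A} {f : Wreath.Hom X Y} {g : Wreath.Hom Y Z}
    {i : Fin (G.obj X.base).card} {l : Fin (G.obj Z.base).card}
    (h : l ∈ (G.map (f.base ≫ g.base)).sets i) :
    ∃ j, j ∈ (G.map f.base).sets i ∧ l ∈ (G.map g.base).sets j := by
  rw [G.map_comp] at h
  exact Gam.mem_comp.1 h

/-- The composition of operators: the component `A_i → C_l` of a composite is the composite of the
components `A_i → B_j → C_l`, where `j` is the unique element of `G(φ)(i)` with `l ∈ G(ψ)(j)`. -/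
noncomputable def Wreath.Hom.comp {X Y Z : Wreath G A} (f : Wreath.Hom X Y)
    (g : Wreath.Hom Y Z) : Wreath.Hom X Z where
  base := f.base ≫ g.base
  label i l h :=
    f.label i (Wreath.exists_mem h).choose (Wreath.exists_mem h).choose_spec.1 ≫
      g.label (Wreath.exists_mem h).choose l (Wreath.exists_mem h).choose_spec.2

theorem Wreath.Hom.comp_label {X Y Z : Wreath G A} (f : Wreath.Hom X Y) (g : Wreath.Hom Y Z)
    {i : Fin (G.obj X.base).card} {j : Fin (G.obj Y.base).card} {l : Fin (G.obj Z.base).card}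
    (h : l ∈ (G.map (f.base ≫ g.base)).sets i)
    (hj : j ∈ (G.map f.base).sets i) (hl : l ∈ (G.map g.base).sets j) :
    (f.comp g).label i l h = f.label i j hj ≫ g.label j l hl := by
  have key : ∀ j' (hj' : j' ∈ (G.map f.base).sets i) (hl' : l ∈ (G.map g.base).sets j'),
      f.label i j' hj' ≫ g.label j' l hl' = f.label i j hj ≫ g.label j l hl := by
    intro j' hj' hl'
    obtain rfl := Gam.Hom.eq_of_mem _ hl hl'
    rfl
  exact key _ _ _

noncomputable instance : SmallCategory (Wreath G A) where
  Hom := Wreath.Hom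
  id X :=
    { base := 𝟙 X.base
      label := fun i k h ↦ eqToHom (by
        rw [G.map_id] at h
        rw [Gam.mem_id.1 h]) }
  comp f g := f.comp g
  id_comp {X Y} f := by
    refine Wreath.Hom.ext' (Category.id_comp _) fun i k h h' ↦ ?_
    rw [Wreath.Hom.comp_label (j := i) _ _ h (by rw [G.map_id]; exact Gam.mem_id.2 rfl) h']
    simp
  comp_id {X Y} f := by
    refine Wreath.Hom.ext' (Category.comp_id _) fun i k h h' ↦ ?_
    rw [Wreath.Hom.comp_label (j := k) _ _ h h' (by rw [G.map_id]; exact Gam.mem_id.2 rfl)]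
    simp
  assoc {W X Y Z} f g h := by
    refine Wreath.Hom.ext' (Category.assoc _ _ _) fun i l hl hl' ↦ ?_
    obtain ⟨k, hk, hkl⟩ := Wreath.exists_mem (f := f.comp g) (g := h) hl
    obtain ⟨j, hj, hjk⟩ := Wreath.exists_mem (f := f) (g := g) hk
    have hjl : l ∈ (G.map (g.base ≫ h.base)).sets j := by
      rw [G.map_comp]
      exact Gam.mem_comp.2 ⟨k, hjk, hkl⟩
    rw [Wreath.Hom.comp_label (f.comp g) h hl hk hkl, Wreath.Hom.comp_label f g hk hj hjk,
      Wreath.Hom.comp_label f (g.comp h) hl' hj hjl, Wreath.Hom.comp_label g h hjl hjk hkl,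
      Category.assoc]

/-- The functor `B ≀ A → Γ ≀ A`, `(φ; φ_1, …, φ_m) ↦ (G(φ); φ_1, …, φ_m)`. For `G = γ` this is the
functor `γ ≀ A : Δ ≀ A → Γ ≀ A`. -/
noncomputable def Wreath.toGam (G : B ⥤ Gam) (A : Type) [SmallCategory A] :
    Wreath G A ⥤ Wreath (𝟭 Gam) A where
  obj X := ⟨G.obj X.base, X.label⟩
  map f := Wreath.Hom.mk (G.map f.base) f.label
  map_id X := Wreath.Hom.ext' (G.map_id _) fun i k h h' ↦ rfl
  map_comp {X Y Z} f g := by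
    refine Wreath.Hom.ext' (G.map_comp _ _) fun i l h h' ↦ ?_
    obtain ⟨j, hj, hl⟩ := Wreath.exists_mem (f := f) (g := g) h
    refine (Wreath.Hom.comp_label f g h hj hl).trans ?_
    exact (Wreath.Hom.comp_label (G := 𝟭 Gam)
      (X := ⟨G.obj X.base, X.label⟩) (Y := ⟨G.obj Y.base, Y.label⟩) (Z := ⟨G.obj Z.base, Z.label⟩)
      (Wreath.Hom.mk (G.map f.base) f.label)
      (Wreath.Hom.mk (G.map g.base) g.label) h' hj hl).symm

/-- The functor `B ≀ F : B ≀ A → B ≀ A'` induced by a functor `F : A → A'`. -/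
noncomputable def Wreath.mapLabel (G : B ⥤ Gam) {A A' : Type} [SmallCategory A]
    [SmallCategory A'] (F : A ⥤ A') : Wreath G A ⥤ Wreath G A' where
  obj X := ⟨X.base, fun i ↦ F.obj (X.label i)⟩
  map f := Wreath.Hom.mk f.base fun i k h ↦ F.map (f.label i k h)
  map_id X := Wreath.Hom.ext' rfl fun i k h h' ↦ eqToHom_map F (by
    have h2 := h'
    erw [G.map_id] at h2
    rw [Gam.mem_id.1 h2])
  map_comp {X Y Z} f g := by
    refine Wreath.Hom.ext' rfl fun i l h h' ↦ ?_
    obtain ⟨j, hj, hl⟩ := Wreath.exists_mem (f := f) (g := g) h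
    refine (congrArg F.map (Wreath.Hom.comp_label f g h hj hl)).trans ?_
    rw [F.map_comp]
    exact (Wreath.Hom.comp_label (G := G)
      (X := ⟨X.base, fun i ↦ F.obj (X.label i)⟩) (Y := ⟨Y.base, fun i ↦ F.obj (Y.label i)⟩)
      (Z := ⟨Z.base, fun i ↦ F.obj (Z.label i)⟩)
      (Wreath.Hom.mk f.base fun i k h ↦ F.map (f.label i k h))
      (Wreath.Hom.mk g.base fun i k h ↦ F.map (g.label i k h)) h' hj hl).symm

end Wreath

/-- The functor `α : Γ ≀ Γ → Γ` with `α(n̲_1, …, n̲_k) = n̲` for `n = n_1 + ⋯ + n_k`, the disjoint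
sum: the elements of `α(n̲_1, …, n̲_k)` are the pairs `(i, s)` with `s ∈ n̲_i`, and an operator
`(φ; φ_1, …, φ_m)` goes to `(i, s) ↦ {(k, t) | k ∈ φ(i), t ∈ φ_i^k(s)}`. -/
noncomputable def disjointSum : Wreath (𝟭 Gam) Gam ⥤ Gam where
  obj X := ⟨∑ i : Fin X.base.card, (X.label i).card⟩
  map {X Y} f :=
    { sets := fun p : Fin (∑ i : Fin X.base.card, (X.label i).card) ↦
        {q : Fin (∑ k : Fin Y.base.card, (Y.label k).card) |
          ∃ h : (finSigmaFinEquiv.symm q).1 ∈ f.base.sets (finSigmaFinEquiv.symm p).1,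
            (finSigmaFinEquiv.symm q).2 ∈
              (f.label (finSigmaFinEquiv.symm p).1 (finSigmaFinEquiv.symm q).1 h).sets
                (finSigmaFinEquiv.symm p).2}
      disj := by
        intro p p' hp
        refine Set.disjoint_left.2 ?_
        rintro q ⟨h, hs⟩ ⟨h', hs'⟩
        apply hp
        apply finSigmaFinEquiv.symm.injective
        generalize finSigmaFinEquiv.symm p = P at *
        generalize finSigmaFinEquiv.symm p' = P' at *
        obtain ⟨i, s⟩ := P
        obtain ⟨i', s'⟩ := P'
        obtain rfl := Gam.Hom.eq_of_mem _ h h'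
        obtain rfl := Gam.Hom.eq_of_mem _ hs hs'
        rfl }
  map_id X := by
    refine Gam.hom_ext fun p ↦ ?_
    ext q
    rw [Gam.mem_id]
    refine Iff.trans ?_ (finSigmaFinEquiv.symm.injective.eq_iff (a := q) (b := p))
    change (∃ h : (finSigmaFinEquiv.symm q).1 ∈
        Gam.Hom.sets ((𝟭 Gam).map (𝟙 X.base)) (finSigmaFinEquiv.symm p).1,
      (finSigmaFinEquiv.symm q).2 ∈ Gam.Hom.sets (Wreath.Hom.label (𝟙 X) _ _ h) (finSigmaFinEquiv.symm p).2) ↔ _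
    generalize finSigmaFinEquiv.symm p = P at *
    generalize finSigmaFinEquiv.symm q = Q at *
    obtain ⟨i, s⟩ := P
    obtain ⟨k, t⟩ := Q
    constructor
    · rintro ⟨h, h'⟩
      obtain rfl := Gam.mem_id.1 h
      obtain rfl := Gam.mem_id.1 h'
      rfl
    · intro h
      cases h
      exact ⟨Gam.mem_id.2 rfl, Gam.mem_id.2 rfl⟩
  map_comp {X Y Z} f g := by
    refine Gam.hom_ext fun p ↦ ?_
    ext q
    rw [Gam.mem_comp]
    constructor
    · rintro ⟨h, hs⟩
      obtain ⟨j, hj, hl⟩ := Wreath.exists_mem (f := f) (g := g) h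
      have e := Wreath.Hom.comp_label f g h hj hl
      rw [show Wreath.Hom.label (f ≫ g) _ _ h = _ from e] at hs
      obtain ⟨r, hr, hr'⟩ := Gam.mem_comp.1 hs
      refine ⟨finSigmaFinEquiv (n := fun j ↦ (Y.label j).card) ⟨j, r⟩, ?_⟩
      change (∃ h : (finSigmaFinEquiv.symm (finSigmaFinEquiv (n := fun j ↦ (Y.label j).card) ⟨j, r⟩)).1 ∈ _, _) ∧
        (∃ h : _ ∈ g.base.sets (finSigmaFinEquiv.symm (finSigmaFinEquiv (n := fun j ↦ (Y.label j).card) ⟨j, r⟩)).1, _)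
      rw [Equiv.symm_apply_apply]
      exact ⟨⟨hj, hr⟩, ⟨hl, hr'⟩⟩
    · rintro ⟨r, ⟨hj, hr⟩, ⟨hl, hr'⟩⟩
      have h : (finSigmaFinEquiv.symm q).1 ∈
          Gam.Hom.sets ((𝟭 Gam).map (f.base ≫ g.base)) (finSigmaFinEquiv.symm p).1 :=
        Gam.mem_comp.2 ⟨_, hj, hl⟩
      refine ⟨h, ?_⟩
      have e := Wreath.Hom.comp_label f g h hj hl
      rw [show Wreath.Hom.label (f ≫ g) _ _ h = _ from e]
      exact Gam.mem_comp.2 ⟨_, hr, hr'⟩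

/-! ### The categories `Θ_n`, the assembly functors, and the realisation -/

/-- The diagonal `δ_A : Δ × A → Δ ≀ A`, `([m], a) ↦ (a, …, a)` (`m` times). -/
noncomputable def diag (A : Type) [SmallCategory A] : SimplexCategory × A ⥤ Wreath segal A where
  obj P := ⟨P.1, fun _ ↦ P.2⟩
  map f := Wreath.Hom.mk f.1 fun _ _ _ ↦ f.2
  map_id P := Wreath.Hom.ext' rfl fun i k h h' ↦ (eqToHom_refl P.2 rfl).symm
  map_comp {P Q R} f g := by
    refine Wreath.Hom.ext' rfl fun i l h h' ↦ ?_
    obtain ⟨j, hj, hl⟩ := Wreath.exists_mem (G := segal) (X := ⟨P.1, fun _ ↦ P.2⟩)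
      (Y := ⟨Q.1, fun _ ↦ Q.2⟩) (Z := ⟨R.1, fun _ ↦ R.2⟩)
      (f := Wreath.Hom.mk f.1 fun _ _ _ ↦ f.2) (g := Wreath.Hom.mk g.1 fun _ _ _ ↦ g.2) h
    exact (Wreath.Hom.comp_label (G := segal) (X := ⟨P.1, fun _ ↦ P.2⟩)
      (Y := ⟨Q.1, fun _ ↦ Q.2⟩) (Z := ⟨R.1, fun _ ↦ R.2⟩)
      (Wreath.Hom.mk f.1 fun _ _ _ ↦ f.2) (Wreath.Hom.mk g.1 fun _ _ _ ↦ g.2) h' hj hl).symm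

/-- `Θ_1 = Δ` and `Θ_n = Δ ≀ Θ_{n-1}` for `n ≥ 2` (and `Θ_0` is the one-point category). -/
noncomputable def Theta : ℕ → Cat.{0, 0}
  | 0 => Cat.of (Discrete PUnit)
  | 1 => Cat.of SimplexCategory
  | n + 2 => Cat.of (Wreath segal (Theta (n + 1)))

/-- The assembly functors: `γ_1 = γ : Δ → Γ`, and `γ_n` is the composite of
`γ ≀ γ_{n-1} : Δ ≀ Θ_{n-1} → Γ ≀ Γ` with `α : Γ ≀ Γ → Γ` for `n ≥ 2` (and `γ_0` takes the value
`1̲`). -/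
noncomputable def assembly : ∀ n : ℕ, Theta n ⥤ Gam
  | 0 => (Functor.const (Discrete PUnit)).obj ⟨1⟩
  | 1 => segal
  | n + 2 => Wreath.toGam segal (Theta (n + 1)) ⋙
      Wreath.mapLabel (𝟭 Gam) (assembly (n + 1)) ⋙ disjointSum

/-- The functor `Δ^- : Δ → Top`, `[m] ↦ Δ^m`. -/
noncomputable def simplexSpace : SimplexCategory ⥤ CGTop.{u} :=
  SimplexCategory.toTop.{u} ⋙ kify

/-- The realisation `X ↦ X ⊗_C G` of presheaves of sets on `C`, associated with `G : C → Top`. -/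
noncomputable def realizeSets {C : Type} [SmallCategory C] (G : C ⥤ CGTop.{u}) :
    (Cᵒᵖ ⥤ Type) ⥤ CGTop.{u} :=
  (Functor.whiskeringRight Cᵒᵖ Type CGTop.{u}).obj discreteSpace ⋙ tensor G

/-- The functor `Θ_n^- : Θ_n → Top`, `T ↦ |Θ_n[T]|_{Θ_n}`. For `n = 1` it is `[m] ↦ Δ^m`; for
`n ≥ 2` the realisation of a presheaf `X` on `Θ_n = Δ ≀ Θ_{n-1}` is
`|X|_{Θ_n} = |δ^*X|_{Δ × Θ_{n-1}}`, where `δ : Δ × Θ_{n-1} → Δ ≀ Θ_{n-1}` is the diagonal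
and the realisation of presheaves on `Δ × Θ_{n-1}` is the colimit preserving functor which takes
`Δ[m] × Θ_{n-1}[S]` to `Δ^m × |Θ_{n-1}[S]|_{Θ_{n-1}}`. -/
noncomputable def thetaCell : ∀ n : ℕ, Theta n ⥤ CGTop.{u}
  | 0 => (Functor.const (Discrete PUnit)).obj (kify.obj (TopCat.of PUnit))
  | 1 => simplexSpace
  | n + 2 =>
      (yoneda (C := Wreath segal (Theta (n + 1)))) ⋙
        (Functor.whiskeringLeft (SimplexCategory × Theta (n + 1))ᵒᵖ
          (Wreath segal (Theta (n + 1)))ᵒᵖ Type).obj (diag (Theta (n + 1))).op ⋙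
        realizeSets (simplexSpace.prod (thetaCell (n + 1)) ⋙ kProd)

/-- The geometric realisation `|X|_{Θ_n} = X ⊗_{Θ_n} Θ_n^-` of `Θ_n`-spaces. -/
noncomputable def thetaRealization (n : ℕ) : ((Theta n)ᵒᵖ ⥤ CGTop.{u}) ⥤ CGTop.{u} :=
  tensor (thetaCell n)

/-! ### `Γ`-spaces and the Segal spectrum -/

/-- `Γ`-spaces `A : Γᵒᵖ → Top`; they are reduced: `A(0̲)` is a one-point space. -/
abbrev GammaSpace : Type (u + 1) :=
  ObjectProperty.FullSubcategory
    fun A : Gamᵒᵖ ⥤ CGTop.{u} ↦ Nonempty (Unique (A.obj (op ⟨0⟩)))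

/-- The inverse image `γ_n^*A` of a `Γ`-space along the assembly functor. -/
noncomputable def assemblyPullback (n : ℕ) : GammaSpace.{u} ⥤ ((Theta n)ᵒᵖ ⥤ CGTop.{u}) :=
  ObjectProperty.ι _ ⋙
    (Functor.whiskeringLeft (Theta n)ᵒᵖ Gamᵒᵖ CGTop.{u}).obj (assembly n).op

open Classical in
/-- The map `X^m → X^n` induced by a `Γ`-operator `(M_1, …, M_m) : m̲ → n̲` and a base point `x₀`:
it takes `(x_1, …, x_m)` to `(y_1, …, y_n)` with `y_j = x_i` if `j ∈ M_i`, and `y_j = x₀` if `j`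
lies in none of the `M_i`. -/
noncomputable def powerMap {X : Type u} (x₀ : X) {m n : Gam} (f : m ⟶ n) (x : Fin m.card → X)
    (j : Fin n.card) : X :=
  if h : ∃ i, j ∈ f.sets i then x h.choose else x₀

theorem powerMap_of_mem {X : Type u} (x₀ : X) {m n : Gam} (f : m ⟶ n) (x : Fin m.card → X)
    {i : Fin m.card} {j : Fin n.card} (h : j ∈ f.sets i) : powerMap x₀ f x j = x i := by
  have h' : ∃ i, j ∈ f.sets i := ⟨i, h⟩
  rw [powerMap, dif_pos h', Gam.Hom.eq_of_mem f h'.choose_spec h]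

theorem powerMap_of_notMem {X : Type u} (x₀ : X) {m n : Gam} (f : m ⟶ n) (x : Fin m.card → X)
    {j : Fin n.card} (h : ∀ i, j ∉ f.sets i) : powerMap x₀ f x j = x₀ := by
  rw [powerMap, dif_neg (by simpa using h)]

theorem continuous_powerMap {X : Type u} [TopologicalSpace X] (x₀ : X) {m n : Gam} (f : m ⟶ n) :
    Continuous (powerMap x₀ f) := by
  refine continuous_pi fun j ↦ ?_
  by_cases h : ∃ i, j ∈ f.sets i
  · obtain ⟨i, h⟩ := h
    simpa only [powerMap_of_mem x₀ f _ h] using continuous_apply i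
  · push Not at h
    simpa only [powerMap_of_notMem x₀ f _ h] using continuous_const

/-- The functor `X^- : Γ → Top`, `n̲ ↦ X^n`, associated with a based space `(X, x₀)`. -/
noncomputable def power (X : CGTop.{u}) (x₀ : X) : Gam ⥤ CGTop.{u} where
  obj n := kify.obj (TopCat.of (Fin n.card → X))
  map f := kify.map (TopCat.ofHom ⟨powerMap x₀ f, continuous_powerMap x₀ f⟩)
  map_id n := by
    rw [← kify.map_id]
    congr 1
    ext x j
    exact powerMap_of_mem x₀ (𝟙 n) x (Gam.mem_id.2 rfl)
  map_comp {m n p} f g := by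
    rw [← kify.map_comp]
    congr 1
    ext x l
    change powerMap x₀ (f ≫ g) x l = powerMap x₀ g (powerMap x₀ f x) l
    by_cases h : ∃ j, l ∈ g.sets j
    · obtain ⟨j, hl⟩ := h
      rw [powerMap_of_mem x₀ g _ hl]
      by_cases h' : ∃ i, j ∈ f.sets i
      · obtain ⟨i, hj⟩ := h'
        rw [powerMap_of_mem x₀ f _ hj, powerMap_of_mem x₀ (f ≫ g) _ (Gam.mem_comp.2 ⟨j, hj, hl⟩)]
      · push Not at h'
        rw [powerMap_of_notMem x₀ f _ h']
        refine powerMap_of_notMem x₀ _ _ fun i hi ↦ ?_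
        obtain ⟨j', hj', hl'⟩ := Gam.mem_comp.1 hi
        obtain rfl := Gam.Hom.eq_of_mem g hl hl'
        exact h' i hj'
    · push Not at h
      rw [powerMap_of_notMem x₀ g _ h]
      refine powerMap_of_notMem x₀ _ _ fun i hi ↦ ?_
      obtain ⟨j', hj', hl'⟩ := Gam.mem_comp.1 hi
      exact h j' hl'

/-- The functor `A ↦ A̲(X) = A ⊗_Γ X^-`, for a based space `(X, x₀)`. -/
noncomputable def evalAt (X : CGTop.{u}) (x₀ : X) : GammaSpace.{u} ⥤ CGTop.{u} :=
  ObjectProperty.ι _ ⋙ tensor (power X x₀)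

/-- The `n`-sphere (the unit sphere of `ℝⁿ⁺¹`, a compact Hausdorff space). -/
noncomputable def sphereSpace (n : ℕ) : CGTop.{u} := kify.obj (TopCat.sphere.{u} n)

/-- The base point `(1, 0, …, 0)` of the `n`-sphere. -/
noncomputable def sphereBase (n : ℕ) : sphereSpace.{u} n :=
  (WithGeneratedByTopology.equiv (X := compHausFamily.{u})).symm
    (ULift.up (⟨EuclideanSpace.single (0 : Fin (n + 1)) (1 : ℝ), by simp⟩ :
      Metric.sphere (0 : EuclideanSpace ℝ (Fin (n + 1))) 1))

/-- The `n`-th space `A̲(S^n)` of the Segal spectrum of a `Γ`-space `A`. -/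
noncomputable def segalSpectrumSpace (n : ℕ) : GammaSpace.{u} ⥤ CGTop.{u} :=
  evalAt (sphereSpace n) (sphereBase n)

end ThetaSpaces

/-!
A point of the realisation is represented by a triple `(c, a, x)` with `x` a point of the cell of
`c`, and such a cell carries natural coordinates in `S^n`, one for each element of `γ_n(c)`. Hence
`(c, a, x)` determines the point `(a, coord x)` of `A ⊗_Γ (S^n)^-`. This is a homeomorphism because
the functor `(S^n)^-` is the left Kan extension of the cells along `γ_n`:

* every tuple of points of `S^n` is the image of the coordinates of some cell under a
  `Γ`-operator; finitely many operators and one compact cell suffice for all tuples of a given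
  length, so that `(S^n)^k` is a quotient of finitely many copies of that cell;
* two points of cells are images of a single point with generic coordinates (pairwise distinct and
  different from the base point), and a `Γ`-operator is determined by its effect on a generic
  tuple, so that any two representations of a tuple are identified in the realisation.

For `n = 1` the coordinates of a point of `Δ^m` are the images in `S^1 = [0, 1] / {0, 1}` of the
partial sums of its barycentric coordinates. For `Δ ≀ Θ_n` they are the products of the coordinates
in `S^1` and `S^n`, under the collapse map `S^1 × S^n → S^1 ∧ S^n = S^(n+1)`.
-/

namespace ThetaSpaces

/-! ### Products of compactly generated spaces -/

instance isGeneratedBy_of_compactSpace (K : Type u) [TopologicalSpace K] [CompactSpace K]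
    [T2Space K] : IsGeneratedBy compHausFamily.{u} K :=
  inferInstanceAs (IsGeneratedBy compHausFamily.{u} (compHausFamily.{u} (CompHaus.of K)))

instance (K : CompHaus.{u}) : LocallyCompactSpace (compHausFamily.{u} K) :=
  have locallyCompactSpace (T : Type u) [TopologicalSpace T] [CompactSpace T] [T2Space T] :
    LocallyCompactSpace T := inferInstance
  locallyCompactSpace K.toTop

/-- The bijection between the points of `kify Y` and those of `Y`. -/
noncomputable def kifyEquiv (Y : TopCat.{u}) : kify.obj Y ≃ Y :=
  WithGeneratedByTopology.equiv (X := compHausFamily.{u}) (Y := Y)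

theorem continuous_kifyEquiv (Y : TopCat.{u}) : Continuous (kifyEquiv Y) :=
  WithGeneratedByTopology.continuous_equiv

theorem continuous_kifyEquiv_comp_iff {Z : Type*} [TopologicalSpace Z]
    [IsGeneratedBy compHausFamily.{u} Z] {Y : TopCat.{u}} {g : Z → kify.obj Y} :
    Continuous (fun z ↦ kifyEquiv Y (g z)) ↔ Continuous g :=
  (IsGeneratedBy.equiv_symm_comp_continuous_iff (X := compHausFamily.{u})
    fun z ↦ kifyEquiv Y (g z)).symm

instance (Y : TopCat.{u}) [T2Space Y] : T2Space (kify.obj Y) :=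
  .of_injective_continuous (kifyEquiv Y).injective (continuous_kifyEquiv Y)

/-- Currying turns the claim into the universal property of `q` for maps into a mapping space. -/
theorem continuousGeneratedBy_of_isQuotientMap {ι : Type*} {X : ι → Type*}
    [∀ i, TopologicalSpace (X i)] [∀ i, LocallyCompactSpace (X i)]
    [∀ i j, IsGeneratedBy X (X i × X j)] {Y Q P Z : Type*} [TopologicalSpace Y]
    [TopologicalSpace Q] [TopologicalSpace P] [TopologicalSpace Z] [IsGeneratedBy X Q]
    {q : Q → P} (hq : IsQuotientMap q) (g : Y × P → Z)
    (hg : ContinuousGeneratedBy X fun x : Y × Q ↦ g (x.1, q x.2)) :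
    ContinuousGeneratedBy X g := by
  have hg_left (p : P) : ContinuousGeneratedBy X fun y ↦ g (y, p) := by
    obtain ⟨t, rfl⟩ := hq.surjective p
    exact hg.comp (Continuous.prodMk_left t).continuousGeneratedBy
  let curried : P → ContinuousMapGeneratedBy X Y Z := fun p ↦ ⟨_, hg_left p⟩
  have continuous_curried : Continuous curried := by
    rw [hq.continuous_iff, IsGeneratedBy.continuous_iff X]
    exact (ContinuousMapGeneratedBy.curryEquiv
      (⟨_, hg⟩ : ContinuousMapGeneratedBy X (Y × Q) Z)).prop
  exact (ContinuousMapGeneratedBy.curryEquiv.symm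
    ⟨curried, continuous_curried.continuousGeneratedBy⟩).prop

/-! ### Tensor products -/

section TensorMk

variable {C : Type} [SmallCategory C] {F : Cᵒᵖ ⥤ CGTop.{u}} {G : C ⥤ CGTop.{u}}

/-- The class of `(x, y) ∈ F(c) × G(c)` in `F ⊗_C G`. -/
noncomputable def tensorMk (c : C) (x : F.obj (op c)) (y : G.obj c) : tensorObj F G :=
  Quot.mk _ ⟨c, (kifyEquiv (.of (F.obj (op c) × G.obj c))).symm (x, y)⟩

theorem tensorMk_glue {c d : C} (f : c ⟶ d) (x : F.obj (op d)) (y : G.obj c) :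
    tensorMk (F := F) c ((F.map f.op).hom x) y = tensorMk d x ((G.map f).hom y) :=
  Quot.sound (TensorRel.glue f x y)

theorem exists_tensorMk_eq (z : tensorObj F G) :
    ∃ c x y, tensorMk (F := F) (G := G) c x y = z := by
  obtain ⟨⟨c, p⟩, rfl⟩ := Quot.exists_rep (r := TensorRel F G) z
  exact ⟨c, p.1, p.2, rfl⟩

/-- The map out of `F ⊗_C G` induced by a family of maps compatible with the identifications. -/
noncomputable def tensorLift {Z : Type*} (g : ∀ c, F.obj (op c) → G.obj c → Z)
    (hg : ∀ {c d : C} (f : c ⟶ d) (x : F.obj (op d)) (y : G.obj c),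
      g c ((F.map f.op).hom x) y = g d x ((G.map f).hom y)) : tensorObj F G → Z :=
  Quot.lift (fun p ↦ g p.1 (kifyEquiv _ p.2).1 (kifyEquiv _ p.2).2) (by
    rintro _ _ ⟨f, x, y⟩
    exact hg f x y)

theorem continuous_tensor_iff {Z : Type u} [TopologicalSpace Z] {g : tensorObj F G → Z} :
    Continuous g ↔ ∀ c, ContinuousGeneratedBy compHausFamily.{u}
      fun p : F.obj (op c) × G.obj c ↦ g (tensorMk c p.1 p.2) := by
  refine (isQuotientMap_quot_mk (r := TensorRel F G)).continuous_iff.trans ?_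
  refine continuous_sigma_iff.trans (forall_congr' fun c ↦ ?_)
  exact WithGeneratedByTopology.continuous_from_iff (Y := F.obj (op c) × G.obj c) _

theorem continuousGeneratedBy_tensorMk (c : C) : ContinuousGeneratedBy compHausFamily.{u}
    fun p : F.obj (op c) × G.obj c ↦ tensorMk (F := F) (G := G) c p.1 p.2 :=
  continuous_tensor_iff.1 continuous_id c

theorem continuous_tensorMk {Z : Type*} [TopologicalSpace Z] [IsGeneratedBy compHausFamily.{u} Z]
    (c : C) {a : Z → F.obj (op c)} {b : Z → G.obj c} (ha : Continuous a) (hb : Continuous b) :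
    Continuous fun z ↦ tensorMk (F := F) (G := G) c (a z) (b z) := by
  rw [IsGeneratedBy.continuous_iff compHausFamily.{u}]
  exact (continuousGeneratedBy_tensorMk c).comp (ha.prodMk hb).continuousGeneratedBy

end TensorMk

/-! ### Powers of based spaces -/

section Power

/-- A tuple is generic if its entries are distinct from each other and from the base point. A
`Γ`-operator is determined by what it does to a generic tuple. -/
structure IsGeneric {ι X : Type*} (x₀ : X) (x : ι → X) : Prop where
  injective : Function.Injective x
  ne_base : ∀ i, x i ≠ x₀

variable {X : Type u} {x₀ : X} {m n p : Gam}

theorem powerMap_id (x : Fin m.card → X) : powerMap x₀ (𝟙 m) x = x :=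
  funext fun _ ↦ powerMap_of_mem x₀ (𝟙 m) x (Gam.mem_id.2 rfl)

theorem powerMap_comp (f : m ⟶ n) (g : n ⟶ p) (x : Fin m.card → X) :
    powerMap x₀ (f ≫ g) x = powerMap x₀ g (powerMap x₀ f x) :=
  ConcreteCategory.congr_hom
    ((power (kify.obj (TopCat.discrete.obj X)) x₀).map_comp f g) x

theorem IsGeneric.mem_sets_iff {x : Fin m.card → X} (hx : IsGeneric x₀ x) (f : m ⟶ n)
    (i : Fin m.card) (j : Fin n.card) : j ∈ f.sets i ↔ powerMap x₀ f x j = x i := by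
  refine ⟨powerMap_of_mem x₀ f x, fun h ↦ ?_⟩
  by_cases hj : ∃ i', j ∈ f.sets i'
  · obtain ⟨i', hi'⟩ := hj
    rw [powerMap_of_mem x₀ f x hi'] at h
    rwa [← hx.injective h]
  · rw [powerMap_of_notMem x₀ f x (not_exists.1 hj)] at h
    exact absurd h.symm (hx.ne_base i)

theorem IsGeneric.powerMap_left_injective {x : Fin m.card → X} (hx : IsGeneric x₀ x) :
    Function.Injective fun f : m ⟶ n ↦ powerMap x₀ f x := by
  intro f g h
  ext i j
  rw [hx.mem_sets_iff, hx.mem_sets_iff, show powerMap x₀ f x = powerMap x₀ g x from h]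

theorem exists_powerMap_eq {x : Fin m.card → X} {z : Fin n.card → X}
    (h : ∀ j, z j ≠ x₀ → ∃ i, x i = z j) : ∃ f : m ⟶ n, powerMap x₀ f x = z := by
  choose i hi using h
  let f : m ⟶ n := Gam.Hom.mk (fun k ↦ {j | ∃ hj : z j ≠ x₀, i j hj = k}) fun k k' hk ↦ by
    refine Set.disjoint_left.2 ?_
    rintro j ⟨hj, rfl⟩ ⟨hj', rfl⟩
    exact hk rfl
  refine ⟨f, funext fun j ↦ ?_⟩
  by_cases hj : z j = x₀
  · rw [powerMap_of_notMem x₀ f x fun k ⟨hj', _⟩ ↦ hj' hj, hj]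
  · rw [powerMap_of_mem x₀ f x (show j ∈ f.sets (i j hj) from ⟨hj, rfl⟩), hi]

instance (m n : Gam) : Finite (m ⟶ n) :=
  Finite.of_injective (fun f : m ⟶ n ↦ f.sets) fun _ _ h ↦ Gam.Hom.ext h

instance (m n : Gam) : TopologicalSpace (m ⟶ n) := ⊥

instance (m n : Gam) : DiscreteTopology (m ⟶ n) := ⟨rfl⟩

/-- The bijection between the points of `X^-(n̲)` and the `n`-tuples of points of `X`. -/
noncomputable def powerEquiv (X : CGTop.{u}) (x₀ : X) (n : Gam) :
    (power X x₀).obj n ≃ (Fin n.card → X) :=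
  kifyEquiv (.of (Fin n.card → X))

theorem continuous_powerEquiv_comp_iff {X : CGTop.{u}} {x₀ : X} {Z : Type*} [TopologicalSpace Z]
    [IsGeneratedBy compHausFamily.{u} Z] {g : Z → (power X x₀).obj n} :
    Continuous (fun z ↦ powerEquiv X x₀ n (g z)) ↔ Continuous g :=
  continuous_kifyEquiv_comp_iff (Y := .of (Fin n.card → X))

instance (X : CGTop.{u}) [T2Space X] (x₀ : X) (n : Gam) : T2Space ((power X x₀).obj n) :=
  inferInstanceAs (T2Space (kify.obj (.of (Fin n.card → X))))

end Power

/-! ### Coordinates on cells -/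

/-- Natural coordinates on the cells `G(c)`, with values in a based space `(M, m₀)`, which exhibit
`M^-` as the left Kan extension of `G` along `γ`. The conditions `exists_refinement` and
`exists_cover` make the canonical map `γ^*A ⊗_C G → A ⊗_Γ M^-` injective, respectively a
quotient map. -/
structure CellCoords {C : Type} [SmallCategory C] (γ : C ⥤ Gam) (G : C ⥤ CGTop.{u}) (M : Type u)
    [TopologicalSpace M] (m₀ : M) where
  coord : ∀ c, G.obj c → Fin (γ.obj c).card → M
  continuous_coord : ∀ c, Continuous (coord c)
  naturality : ∀ {c d : C} (f : c ⟶ d) (x : G.obj c),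
    coord d ((G.map f).hom x) = powerMap m₀ (γ.map f) (coord c x)
  exists_refinement : ∀ (c c' : C) (x : G.obj c) (x' : G.obj c'), ∃ (d : C) (s : G.obj d)
    (f : d ⟶ c) (f' : d ⟶ c'),
      (G.map f).hom s = x ∧ (G.map f').hom s = x' ∧ IsGeneric m₀ (coord d s)
  exists_cover : ∀ k : ℕ, ∃ (c : C) (K : CompHaus.{u}) (κ : K.toTop → G.obj c), Continuous κ ∧
    ∀ W : Finset M, W.card ≤ k → m₀ ∉ W → ∃ y, ↑W ⊆ Set.range (coord c (κ y))

namespace CellCoords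

variable {C : Type} [SmallCategory C] {γ : C ⥤ Gam} {G : C ⥤ CGTop.{u}} {M : CGTop.{u}} {m₀ : M}
  (D : CellCoords γ G M m₀) (A : Gamᵒᵖ ⥤ CGTop.{u})

include D in
theorem exists_powerMap_coord_eq (p : Gam) :
    ∃ (c : C) (K : CompHaus.{u}) (κ : K.toTop → G.obj c), Continuous κ ∧
      ∀ z : Fin p.card → M, ∃ (f : γ.obj c ⟶ p) (y : K.toTop),
        powerMap m₀ f (D.coord c (κ y)) = z := by
  classical
  obtain ⟨c, K, κ, hκ, hcover⟩ := D.exists_cover p.card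
  refine ⟨c, K, κ, hκ, fun z ↦ ?_⟩
  obtain ⟨y, hy⟩ := hcover ((Finset.univ.image z).erase m₀)
    ((Finset.card_erase_le.trans Finset.card_image_le).trans (by simp)) (by simp)
  obtain ⟨f, hf⟩ := exists_powerMap_eq (x₀ := m₀) (x := D.coord c (κ y)) (z := z)
    fun j hj ↦ hy (by simp [hj])
  exact ⟨f, y, hf⟩

theorem exists_rep {p : Gam} (z : (power M m₀).obj p) : ∃ r : Σ c, (γ.obj c ⟶ p) × G.obj c,
    powerMap m₀ r.2.1 (D.coord r.1 r.2.2) = powerEquiv M m₀ p z := by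
  obtain ⟨c, K, κ, -, hsurj⟩ := D.exists_powerMap_coord_eq p
  obtain ⟨f, y, h⟩ := hsurj (powerEquiv M m₀ p z)
  exact ⟨⟨c, f, κ y⟩, h⟩

theorem exists_isQuotientMap [T2Space M] (p : Gam) :
    ∃ (c : C) (K : CompHaus.{u}) (κ : K.toTop → G.obj c), Continuous κ ∧
      IsQuotientMap fun y : (γ.obj c ⟶ p) × K.toTop ↦
        (powerEquiv M m₀ p).symm (powerMap m₀ y.1 (D.coord c (κ y.2))) := by
  obtain ⟨c, K, κ, hκ, hsurj⟩ := D.exists_powerMap_coord_eq p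
  refine ⟨c, K, κ, hκ, ?_⟩
  set q := fun y : (γ.obj c ⟶ p) × K.toTop ↦
    (powerEquiv M m₀ p).symm (powerMap m₀ y.1 (D.coord c (κ y.2)))
  have continuous_q : Continuous q := by
    rw [← continuous_powerEquiv_comp_iff, continuous_prod_of_discrete_left]
    exact fun f ↦ (continuous_powerMap m₀ f).comp ((D.continuous_coord c).comp hκ)
  have surjective_q : Function.Surjective q := fun z ↦ by
    obtain ⟨f, y, hz⟩ := hsurj (powerEquiv M m₀ p z)
    exact ⟨(f, y), (Equiv.symm_apply_eq _).2 hz⟩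
  exact continuous_q.isClosedMap.isQuotientMap continuous_q surjective_q

/-- Over a common generic refinement, the two operators agree because they agree on a generic
tuple. -/
theorem tensorMk_eq {p : Gam} (a : A.obj (op p)) {c c' : C} {f : γ.obj c ⟶ p} {f' : γ.obj c' ⟶ p}
    {x : G.obj c} {x' : G.obj c'}
    (h : powerMap m₀ f (D.coord c x) = powerMap m₀ f' (D.coord c' x')) :
    tensorMk (F := γ.op ⋙ A) (G := G) c ((A.map f.op).hom a) x =
      tensorMk c' ((A.map f'.op).hom a) x' := by
  obtain ⟨d, s, g, g', rfl, rfl, hs⟩ := D.exists_refinement c c' x x'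
  rw [D.naturality, D.naturality, ← powerMap_comp, ← powerMap_comp] at h
  have operators_eq : γ.map g ≫ f = γ.map g' ≫ f' := hs.powerMap_left_injective h
  rw [← tensorMk_glue (F := γ.op ⋙ A), ← tensorMk_glue (F := γ.op ⋙ A)]
  congr 1
  change (A.map f.op ≫ A.map (γ.map g).op).hom a = (A.map f'.op ≫ A.map (γ.map g').op).hom a
  rw [← A.map_comp, ← A.map_comp, ← op_comp, ← op_comp, operators_eq]

/-- The canonical map `γ^*A ⊗_C G → A ⊗_Γ M^-`. -/
noncomputable def toPower : tensorObj (γ.op ⋙ A) G → tensorObj A (power M m₀) :=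
  tensorLift (fun c a x ↦ tensorMk (F := A) (G := power M m₀) (γ.obj c) a
    ((powerEquiv M m₀ _).symm (D.coord c x))) (by
      intro c d f a x
      rw [D.naturality]
      exact tensorMk_glue (F := A) (G := power M m₀) (γ.map f) a
        ((powerEquiv M m₀ _).symm (D.coord c x)))

theorem continuous_toPower : Continuous (D.toPower A) := by
  rw [continuous_tensor_iff]
  intro c
  have continuous_coord : Continuous fun x ↦ (powerEquiv M m₀ _).symm (D.coord c x) :=
    continuous_powerEquiv_comp_iff.1 (D.continuous_coord c)
  exact (continuousGeneratedBy_tensorMk (F := A) (G := power M m₀) (γ.obj c)).comp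
    (continuous_fst.prodMk (continuous_coord.comp continuous_snd)).continuousGeneratedBy

/-- The inverse of the canonical map `γ^*A ⊗_C G → A ⊗_Γ M^-`. -/
noncomputable def ofPower : tensorObj A (power M m₀) → tensorObj (γ.op ⋙ A) G :=
  tensorLift (fun p a z ↦
    let r := (D.exists_rep z).choose
    tensorMk (F := γ.op ⋙ A) (G := G) r.1 ((A.map r.2.1.op).hom a) r.2.2) (by
      intro p q g a z
      have hz := (D.exists_rep z).choose_spec
      have hgz := (D.exists_rep (((power M m₀).map g).hom z)).choose_spec
      refine Eq.trans ?_ (D.tensorMk_eq A a (f := (D.exists_rep z).choose.2.1 ≫ g)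
        (x := (D.exists_rep z).choose.2.2) ?_)
      · rw [op_comp, A.map_comp]
        rfl
      · rw [powerMap_comp, hz, hgz]
        rfl)

theorem ofPower_tensorMk {p : Gam} (a : A.obj (op p)) {c : C} (f : γ.obj c ⟶ p) (x : G.obj c)
    {z : (power M m₀).obj p} (h : powerMap m₀ f (D.coord c x) = powerEquiv M m₀ p z) :
    D.ofPower A (tensorMk p a z) = tensorMk (F := γ.op ⋙ A) c ((A.map f.op).hom a) x :=
  D.tensorMk_eq A a ((D.exists_rep z).choose_spec.trans h.symm)

theorem ofPower_toPower (x : tensorObj (γ.op ⋙ A) G) : D.ofPower A (D.toPower A x) = x := by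
  obtain ⟨c, a, y, rfl⟩ := exists_tensorMk_eq x
  refine (D.ofPower_tensorMk A a (𝟙 _) y (powerMap_id _)).trans ?_
  rw [op_id, A.map_id]
  rfl

theorem toPower_ofPower (x : tensorObj A (power M m₀)) : D.toPower A (D.ofPower A x) = x := by
  obtain ⟨p, a, z, rfl⟩ := exists_tensorMk_eq x
  obtain ⟨⟨c, f, y⟩, h⟩ := D.exists_rep z
  rw [D.ofPower_tensorMk A a f y h]
  refine (tensorMk_glue (F := A) (G := power M m₀) f a
    ((powerEquiv M m₀ _).symm (D.coord c y))).trans ?_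
  exact congrArg (tensorMk p a) ((Equiv.symm_apply_eq _).2 h)

theorem continuous_ofPower [T2Space M] : Continuous (D.ofPower A) := by
  rw [continuous_tensor_iff]
  intro p
  obtain ⟨c, K, κ, hκ, hq⟩ := D.exists_isQuotientMap p
  refine continuousGeneratedBy_of_isQuotientMap hq _ fun L φ ↦ ?_
  have ofPower_eq (x : A.obj (op p) × (γ.obj c ⟶ p) × K.toTop) :=
    D.ofPower_tensorMk A x.1 x.2.1 (κ x.2.2) ((powerEquiv M m₀ p).apply_symm_apply _).symm
  simp only [Function.comp_def, ofPower_eq]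
  have continuous_operator_fixed : Continuous fun y : (γ.obj c ⟶ p) × L.toTop ↦
      tensorMk (F := γ.op ⋙ A) (G := G) c ((A.map y.1.op).hom (φ y.2).1) (κ (φ y.2).2.2) := by
    rw [continuous_prod_of_discrete_left]
    exact fun f ↦ continuous_tensorMk (F := γ.op ⋙ A) (G := G) c
      ((A.map f.op).hom.hom.continuous.comp φ.continuous.fst) (hκ.comp φ.continuous.snd.snd)
  exact continuous_operator_fixed.comp (φ.continuous.snd.fst.prodMk continuous_id)

/-- The canonical isomorphism `γ^*A ⊗_C G ≅ A ⊗_Γ M^-`, natural in `A`. -/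
noncomputable def tensorIso [T2Space M] :
    (Functor.whiskeringLeft _ _ CGTop.{u}).obj γ.op ⋙ tensor G ≅ tensor (power M m₀) :=
  NatIso.ofComponents
    (fun A ↦ ObjectProperty.isoMk _ (TopCat.isoOfHomeo
      { toFun := D.toPower A
        invFun := D.ofPower A
        left_inv := D.ofPower_toPower A
        right_inv := D.toPower_ofPower A
        continuous_toFun := D.continuous_toPower A
        continuous_invFun := D.continuous_ofPower A }))
    (fun _ ↦ by
      ext x
      obtain ⟨c, a, y, rfl⟩ := exists_tensorMk_eq x
      rfl)

end CellCoords

/-! ### Collapse maps -/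

/-- A continuous map which collapses the complement of `U` to the point `s₀`, and maps `U`
bijectively onto the complement of `s₀`. -/
structure IsCollapse {X S : Type*} [TopologicalSpace X] [TopologicalSpace S] (U : Set X) (s₀ : S)
    (f : X → S) : Prop where
  continuous : Continuous f
  bijOn : Set.BijOn f U {s₀}ᶜ
  eq_base : ∀ x ∉ U, f x = s₀

namespace IsCollapse

variable {X S : Type*} [TopologicalSpace X] [TopologicalSpace S] {U : Set X} {s₀ : S} {f : X → S}

theorem isGeneric (hf : IsCollapse U s₀ f) {ι : Type*} {x : ι → X}
    (injective_x : Function.Injective x) (hxU : ∀ i, x i ∈ U) : IsGeneric s₀ (f ∘ x) where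
  injective i j h := injective_x (hf.bijOn.injOn (hxU i) (hxU j) h)
  ne_base i := hf.bijOn.mapsTo (hxU i)

theorem exists_finset_image_eq (hf : IsCollapse U s₀ f) {W : Finset S} (hW : s₀ ∉ W) :
    ∃ V : Finset X, ↑V ⊆ U ∧ V.card = W.card ∧ f '' V = W := by
  classical
  obtain ⟨V, hVU, injOn_V, hV⟩ := Finset.exists_subset_injOn_image_eq_of_surjOn U W
    (hf.bijOn.surjOn.mono subset_rfl fun w hw (h : w = s₀) ↦ hW (h ▸ hw))
  exact ⟨V, hVU, by rw [← hV, Finset.card_image_of_injOn injOn_V], by rw [← hV, Finset.coe_image]⟩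

end IsCollapse

/-! ### Simplices -/

theorem exists_mem_iff_castSucc_lt {n : ℕ} {s : Set (Fin n)} (hs : IsLowerSet s) :
    ∃ i : Fin (n + 1), ∀ l, l ∈ s ↔ l.castSucc < i := by
  obtain rfl | ⟨i, rfl⟩ := hs.eq_univ_or_Iio
  · exact ⟨Fin.last n, by simp [Fin.castSucc_lt_last]⟩
  · exact ⟨i.castSucc, by simp⟩

theorem sum_filter_castSucc_lt_succ {n : ℕ} {R : Type*} [AddCommMonoid R] (f : Fin n → R)
    (i : Fin n) : ∑ l with l.castSucc < i.succ, f l =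
      ∑ l with l.castSucc < i.castSucc, f l + f i := by
  rw [add_comm (∑ l with _, f l), ← Finset.sum_insert (by simp)]
  congr 1
  ext l
  simp [Fin.castSucc_lt_succ_iff, le_iff_eq_or_lt]

theorem sum_filter_castSucc_lt_sub {n : ℕ} {R : Type*} [AddCommGroup R] (v : Fin (n + 1) → R)
    (j : Fin (n + 1)) : ∑ l : Fin n with l.castSucc < j, (v l.succ - v l.castSucc) = v j - v 0 := by
  induction j using Fin.induction with
  | zero => simp
  | succ j ih => rw [sum_filter_castSucc_lt_succ, ih]; abel

section PartialSum

variable {m n : ℕ}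

/-- The sum of the barycentric coordinates of `t` with index less than `j`. The partial sums
identify the simplex with the space of monotone sequences in the unit interval. -/
noncomputable def partialSum (t : stdSimplex ℝ (Fin n)) (j : Fin (n + 1)) : unitInterval :=
  ⟨∑ i with i.castSucc < j, t i, Finset.sum_nonneg fun i _ ↦ t.2.1 i,
    (Finset.sum_le_univ_sum_of_nonneg t.2.1).trans_eq t.2.2⟩

theorem partialSum_zero (t : stdSimplex ℝ (Fin n)) : partialSum t 0 = 0 :=
  Subtype.ext (by simp [partialSum])

theorem partialSum_last (t : stdSimplex ℝ (Fin n)) : partialSum t (Fin.last n) = 1 :=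
  Subtype.ext (by simp [partialSum, Fin.castSucc_lt_last])

theorem coe_partialSum_succ (t : stdSimplex ℝ (Fin n)) (i : Fin n) :
    (partialSum t i.succ : ℝ) = partialSum t i.castSucc + t i :=
  sum_filter_castSucc_lt_succ t i

theorem monotone_partialSum (t : stdSimplex ℝ (Fin n)) : Monotone (partialSum t) :=
  Fin.monotone_iff_le_succ.2 fun i ↦ Subtype.coe_le_coe.1 <| by
    rw [coe_partialSum_succ]
    exact le_add_of_nonneg_right (t.2.1 i)

theorem partialSum_injective :
    Function.Injective (partialSum : stdSimplex ℝ (Fin n) → Fin (n + 1) → unitInterval) :=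
  fun s t h ↦ stdSimplex.ext <| funext fun i ↦ by
    have hs := coe_partialSum_succ s i
    rw [h, coe_partialSum_succ] at hs
    exact (add_left_cancel hs).symm

theorem continuous_partialSum (j : Fin (n + 1)) :
    Continuous fun t : stdSimplex ℝ (Fin n) ↦ partialSum t j :=
  (continuous_finsetSum _ fun i _ ↦
    (continuous_apply i).comp continuous_subtype_val).subtype_mk _

theorem coe_partialSum_map (f : Fin m → Fin n) (t : stdSimplex ℝ (Fin m)) (j : Fin (n + 1)) :
    (partialSum (stdSimplex.map f t) j : ℝ) = ∑ i with (f i).castSucc < j, t i := by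
  simp only [partialSum, stdSimplex.map_coe, FunOnFinite.linearMap_apply_apply,
    Finset.sum_fiberwise_eq_sum_filter, Finset.mem_filter_univ]

theorem partialSum_map_eq {f : Fin m → Fin n} (t : stdSimplex ℝ (Fin m)) {j : Fin (n + 1)}
    {i : Fin (m + 1)} (h : ∀ l, (f l).castSucc < j ↔ l.castSucc < i) :
    partialSum (stdSimplex.map f t) j = partialSum t i :=
  Subtype.ext <| (coe_partialSum_map f t j).trans <|
    Finset.sum_congr (Finset.filter_congr fun l _ ↦ h l) fun _ _ ↦ rfl

theorem exists_partialSum_eq {v : Fin (n + 1) → unitInterval} (hv : Monotone v) (h₀ : v 0 = 0)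
    (h₁ : v (Fin.last n) = 1) : ∃ t, partialSum t = v := by
  have sum_diff (j : Fin (n + 1)) :
      ∑ l : Fin n with l.castSucc < j, ((v l.succ : ℝ) - v l.castSucc) = v j := by
    rw [sum_filter_castSucc_lt_sub fun i ↦ (v i : ℝ), h₀, Set.Icc.coe_zero, sub_zero]
  refine ⟨⟨fun i ↦ v i.succ - v i.castSucc, fun i ↦ sub_nonneg.2 (hv i.castSucc_le_succ), ?_⟩,
    funext fun j ↦ Subtype.ext (sum_diff j)⟩
  simpa [Fin.castSucc_lt_last, h₁] using sum_diff (Fin.last n)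

theorem exists_partialSum_strictMono {W : Finset unitInterval} (h₀ : 0 ∈ W) (h₁ : 1 ∈ W)
    (hW : W.card = n + 1) :
    ∃ t : stdSimplex ℝ (Fin n), StrictMono (partialSum t) ∧ Set.range (partialSum t) = W := by
  have range_emb : Set.range (W.orderEmbOfFin hW) = W := W.range_orderEmbOfFin hW
  obtain ⟨i, hi⟩ := range_emb.symm.subset h₀
  obtain ⟨j, hj⟩ := range_emb.symm.subset h₁
  obtain ⟨t, ht⟩ := exists_partialSum_eq (W.orderEmbOfFin hW).monotone
    (le_antisymm (((W.orderEmbOfFin hW).monotone (Fin.zero_le i)).trans_eq hi)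
      unitInterval.nonneg')
    (le_antisymm unitInterval.le_one'
      (hj.symm.trans_le ((W.orderEmbOfFin hW).monotone (Fin.le_last j))))
  exact ⟨t, ht ▸ (W.orderEmbOfFin hW).strictMono, ht ▸ range_emb⟩

theorem exists_map_eq_of_range_partialSum_subset {s : stdSimplex ℝ (Fin m)}
    {t : stdSimplex ℝ (Fin n)} (hs : StrictMono (partialSum s))
    (hst : Set.range (partialSum t) ⊆ Set.range (partialSum s)) :
    ∃ φ : Fin m →o Fin n, stdSimplex.map φ s = t := by
  have exists_index (l : Fin m) :
      ∃ k : Fin n, ∀ j, partialSum t j ≤ partialSum s l.castSucc ↔ j ≤ k.castSucc := by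
    obtain h | ⟨a, ha⟩ := ((isLowerSet_Iic (partialSum s l.castSucc)).preimage
      (monotone_partialSum t)).eq_univ_or_Iio
    · have one_le : partialSum t (Fin.last n) ≤ partialSum s l.castSucc := h.symm.subset trivial
      rw [partialSum_last, ← partialSum_last s] at one_le
      exact absurd (hs (Fin.castSucc_lt_last l)) one_le.not_gt
    · have zero_lt : 0 < a := ha.subset
        (show partialSum t 0 ≤ _ from (partialSum_zero t).trans_le unitInterval.nonneg')
      obtain ⟨k, rfl⟩ := Fin.exists_succ_eq.2 zero_lt.ne'
      exact ⟨k, fun j ↦ (Set.ext_iff.1 ha j).trans Fin.le_castSucc_iff.symm⟩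
  choose φ hφ using exists_index
  have monotone_φ : Monotone φ := fun l l' h ↦ by
    rw [← Fin.castSucc_le_castSucc_iff, ← hφ]
    exact ((hφ _ _).2 le_rfl).trans (hs.monotone (Fin.castSucc_le_castSucc_iff.2 h))
  refine ⟨⟨φ, monotone_φ⟩, partialSum_injective (funext fun j ↦ ?_)⟩
  obtain ⟨i, hi⟩ := hst ⟨j, rfl⟩
  rw [← hi]
  refine partialSum_map_eq s fun l ↦ ?_
  rw [← hs.lt_iff_lt, hi, ← not_le, ← not_le]
  exact not_congr (hφ l j).symm

end PartialSum

section SimplexSpace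

theorem exists_eq_castSucc_succ {n : ℕ} {t : stdSimplex ℝ (Fin (n + 1))} {j : Fin (n + 2)}
    (hj : partialSum t j ∈ Set.Ioo 0 1) : ∃ i : Fin n, j = i.castSucc.succ := by
  cases j using Fin.cases with
  | zero => exact absurd (partialSum_zero t) hj.1.ne'
  | succ j =>
    cases j using Fin.lastCases with
    | last => exact absurd (partialSum_last t) hj.2.ne
    | cast i => exact ⟨i, rfl⟩

/-- The bijection between the points of `Δ^m` and the points of the standard simplex. -/
noncomputable def simplexEquiv (X : SimplexCategory) :
    simplexSpace.{u}.obj X ≃ stdSimplex ℝ (Fin (X.len + 1)) :=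
  (kifyEquiv (SimplexCategory.toTop.{u}.obj X)).trans Equiv.ulift

theorem continuous_simplexEquiv (X : SimplexCategory) : Continuous (simplexEquiv.{u} X) :=
  continuous_uliftDown.comp (continuous_kifyEquiv _)

theorem continuous_simplexEquiv_symm_comp {K : Type*} [TopologicalSpace K]
    [IsGeneratedBy compHausFamily.{u} K] {X : SimplexCategory}
    {g : K → stdSimplex ℝ (Fin (X.len + 1))} (hg : Continuous g) :
    Continuous fun y ↦ (simplexEquiv.{u} X).symm (g y) :=
  continuous_kifyEquiv_comp_iff (Y := SimplexCategory.toTop.{u}.obj X) |>.1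
    (continuous_uliftUp.comp hg)

/-- The coordinates of a point of `Δ^m` in the circle, regarded as a quotient `e` of the unit
interval: the images of its `m` inner partial sums. -/
noncomputable def simplexCoord {M : Type*} (e : unitInterval → M) (X : SimplexCategory)
    (x : simplexSpace.{u}.obj X) (j : Fin (segal.obj X).card) : M :=
  e (partialSum (simplexEquiv X x) (Fin.succ (n := X.len + 1) (Fin.castSucc (n := X.len) j)))

theorem simplexCoord_map {M : Type u} {m₀ : M} {e : unitInterval → M} (h₀ : e 0 = m₀)
    (h₁ : e 1 = m₀) {X Y : SimplexCategory} (φ : X ⟶ Y) (x : simplexSpace.{u}.obj X) :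
    simplexCoord e Y ((simplexSpace.map φ).hom x) =
      powerMap m₀ (segal.map φ) (simplexCoord e X x) := by
  funext (j : Fin Y.len)
  have lt_iff (l : Fin (X.len + 1)) :
      (φ.toOrderHom l).castSucc < j.castSucc.succ ↔ φ.toOrderHom l < j.succ := by
    rw [Fin.castSucc_lt_succ_iff, Fin.le_castSucc_iff]
  obtain ⟨i, hi⟩ := exists_mem_iff_castSucc_lt
    ((isLowerSet_Iio j.succ).preimage φ.toOrderHom.monotone)
  have coord_eq : simplexCoord e Y ((simplexSpace.map φ).hom x) j =
      e (partialSum (simplexEquiv X x) i) :=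
    congrArg e (partialSum_map_eq _ fun l ↦ (lt_iff l).trans (hi l))
  rw [coord_eq]
  have mem_sets_iff (k : Fin X.len) :
      j ∈ (segal.map φ).sets k ↔ k.castSucc.castSucc < i ∧ ¬ k.succ.castSucc < i := by
    rw [← hi, ← hi]
    exact and_congr_right' not_lt.symm
  cases i using Fin.cases with
  | zero =>
    rw [partialSum_zero, h₀]
    exact (powerMap_of_notMem m₀ (segal.map φ) _ fun k hk ↦
      Fin.not_lt_zero _ ((mem_sets_iff k).1 hk).1).symm
  | succ i =>
    cases i using Fin.lastCases with
    | last =>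
      rw [Fin.succ_last, partialSum_last, h₁]
      exact (powerMap_of_notMem m₀ (segal.map φ) _ fun k hk ↦
        ((mem_sets_iff k).1 hk).2 (Fin.castSucc_lt_last _)).symm
    | cast k =>
      have mem_sets : j ∈ (segal.map φ).sets k :=
        (mem_sets_iff k).2 ⟨Fin.castSucc_lt_succ, lt_irrefl k.succ.castSucc⟩
      exact (powerMap_of_mem m₀ (segal.map φ) (simplexCoord e X x) mem_sets).symm

theorem exists_simplex_refinement {X X' : SimplexCategory} (x : simplexSpace.{u}.obj X)
    (x' : simplexSpace.{u}.obj X') :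
    ∃ (Y : SimplexCategory) (s : simplexSpace.{u}.obj Y) (f : Y ⟶ X) (f' : Y ⟶ X'),
      (simplexSpace.map f).hom s = x ∧ (simplexSpace.map f').hom s = x' ∧
        StrictMono (partialSum (simplexEquiv Y s)) := by
  classical
  let W : Finset unitInterval := Finset.univ.image (partialSum (simplexEquiv X x)) ∪
    Finset.univ.image (partialSum (simplexEquiv X' x'))
  have zero_mem : 0 ∈ W := Finset.mem_union_left _ <|
    Finset.mem_image.2 ⟨0, Finset.mem_univ _, partialSum_zero _⟩
  have one_mem : 1 ∈ W := Finset.mem_union_left _ <|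
    Finset.mem_image.2 ⟨Fin.last _, Finset.mem_univ _, partialSum_last _⟩
  obtain ⟨n, hn⟩ : ∃ n, W.card = n + 2 := Nat.exists_eq_add_of_le' <|
    Finset.one_lt_card.2 ⟨0, zero_mem, 1, one_mem, zero_ne_one⟩
  obtain ⟨s, strictMono_s, range_s⟩ := exists_partialSum_strictMono zero_mem one_mem hn
  obtain ⟨φ, hφ⟩ := exists_map_eq_of_range_partialSum_subset (t := simplexEquiv X x)
    strictMono_s (by simp [range_s, W])
  obtain ⟨φ', hφ'⟩ := exists_map_eq_of_range_partialSum_subset (t := simplexEquiv X' x')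
    strictMono_s (by simp [range_s, W])
  exact ⟨.mk n, (simplexEquiv _).symm s, .mk φ, .mk φ', (simplexEquiv X).injective hφ,
    (simplexEquiv X').injective hφ', strictMono_s⟩

theorem exists_subset_range_partialSum {n : ℕ} {V : Finset unitInterval} (hV : V.card ≤ n) :
    ∃ t : stdSimplex ℝ (Fin (n + 1)), ↑V ⊆ Set.range (partialSum t) := by
  classical
  have : Infinite unitInterval := Set.Icc.infinite one_pos
  obtain ⟨W, hVW, hW⟩ := Infinite.exists_superset_card_eq (insert 0 (insert 1 V)) (n + 2)
    (((Finset.card_insert_le _ _).trans (Nat.succ_le_succ (Finset.card_insert_le _ _))).trans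
      (Nat.add_le_add_right hV 2))
  obtain ⟨t, -, range_t⟩ := exists_partialSum_strictMono (hVW (by simp)) (hVW (by simp)) hW
  exact ⟨t, range_t ▸ fun v hv ↦ hVW (by simp [Finset.mem_coe.1 hv])⟩

/-- The coordinates of the simplices in the circle. -/
noncomputable def IsCollapse.simplexCoords {M : Type u} [TopologicalSpace M] {m₀ : M}
    {e : unitInterval → M} (he : IsCollapse (Set.Ioo 0 1) m₀ e) :
    CellCoords segal simplexSpace.{u} M m₀ where
  coord X := simplexCoord e X
  continuous_coord X := continuous_pi fun _ ↦ he.continuous.comp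
    ((continuous_partialSum _).comp (continuous_simplexEquiv X))
  naturality φ := simplexCoord_map (he.eq_base 0 (by simp)) (he.eq_base 1 (by simp)) φ
  exists_refinement X X' x x' := by
    obtain ⟨Y, s, f, f', hf, hf', hs⟩ := exists_simplex_refinement x x'
    refine ⟨Y, s, f, f', hf, hf', he.isGeneric (fun i j h ↦ ?_) fun i ↦ ⟨?_, ?_⟩⟩
    · exact Fin.castSucc_injective Y.len (Fin.succ_injective _ (hs.injective h))
    · exact (partialSum_zero _).symm.trans_lt (hs (Fin.succ_pos _))
    · exact (hs (Fin.succ_lt_succ_iff.2 (Fin.castSucc_lt_last _))).trans_eq (partialSum_last _)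
  exists_cover k := by
    refine ⟨.mk k, CompHaus.of (ULift.{u} (stdSimplex ℝ (Fin (k + 1)))),
      fun y ↦ (simplexEquiv _).symm y.down,
      continuous_simplexEquiv_symm_comp continuous_uliftDown, fun W hW hm ↦ ?_⟩
    obtain ⟨V, hV, card_V, image_V⟩ := he.exists_finset_image_eq hm
    obtain ⟨t, ht⟩ := exists_subset_range_partialSum (card_V.trans_le hW)
    refine ⟨ULift.up t, fun w hw ↦ ?_⟩
    obtain ⟨v, hv, rfl⟩ := image_V.symm.subset hw
    obtain ⟨j, rfl⟩ := ht hv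
    obtain ⟨i, rfl⟩ := exists_eq_castSucc_succ (hV hv)
    exact ⟨i, rfl⟩

end SimplexSpace

/-! ### Smash products -/

section Smash

variable {M₁ M M' : Type u} {m₁ : M₁} {m₀ : M} {m₀' : M'} {μ : M₁ × M → M'} {a b a' b' : Gam}

/-- The family `μ(x_i, y_r)`, where the pairs `(i, r)` are listed in the order used by the disjoint
sum of `Γ`-operators. -/
def smashCoord (μ : M₁ × M → M') (x : Fin a.card → M₁) (y : Fin b.card → M)
    (q : Fin (∑ _ : Fin a.card, b.card)) : M' :=
  μ (x (finSigmaFinEquiv.symm q).1, y (finSigmaFinEquiv.symm q).2)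

theorem smashCoord_finSigmaFinEquiv (x : Fin a.card → M₁) (y : Fin b.card → M) (i : Fin a.card)
    (r : Fin b.card) :
    smashCoord μ x y (finSigmaFinEquiv (n := fun _ : Fin a.card ↦ b.card) ⟨i, r⟩) =
      μ (x i, y r) := by
  rw [smashCoord, Equiv.symm_apply_apply]

theorem smashCoord_powerMap (hμ : ∀ p, p ∉ {m₁}ᶜ ×ˢ {m₀}ᶜ → μ p = m₀') (φ : a ⟶ a') (ψ : b ⟶ b')
    (χ : Gam.mk (∑ _ : Fin a.card, b.card) ⟶ Gam.mk (∑ _ : Fin a'.card, b'.card))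
    (hχ : ∀ p q, q ∈ χ.sets p ↔
      (finSigmaFinEquiv.symm q).1 ∈ φ.sets (finSigmaFinEquiv.symm p).1 ∧
        (finSigmaFinEquiv.symm q).2 ∈ ψ.sets (finSigmaFinEquiv.symm p).2)
    (x : Fin a.card → M₁) (y : Fin b.card → M) :
    smashCoord μ (powerMap m₁ φ x) (powerMap m₀ ψ y) = powerMap m₀' χ (smashCoord μ x y) := by
  funext q
  by_cases hq : ∃ p, q ∈ χ.sets p
  · obtain ⟨p, hp⟩ := hq
    rw [powerMap_of_mem _ _ _ hp, smashCoord, powerMap_of_mem _ _ _ ((hχ p q).1 hp).1,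
      powerMap_of_mem _ _ _ ((hχ p q).1 hp).2, smashCoord]
  · rw [powerMap_of_notMem _ _ _ (not_exists.1 hq), smashCoord]
    refine hμ _ fun ⟨hx, hy⟩ ↦ hq ?_
    obtain ⟨i, hi⟩ := not_forall_not.1 (mt (powerMap_of_notMem m₁ φ x) hx)
    obtain ⟨r, hr⟩ := not_forall_not.1 (mt (powerMap_of_notMem m₀ ψ y) hy)
    refine ⟨finSigmaFinEquiv (n := fun _ : Fin a.card ↦ b.card) ⟨i, r⟩, (hχ _ _).2 ?_⟩
    rw [Equiv.symm_apply_apply]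
    exact ⟨hi, hr⟩

variable [TopologicalSpace M₁] [TopologicalSpace M] [TopologicalSpace M']

theorem continuous_smashCoord (hμ : Continuous μ) :
    Continuous fun p : (Fin a.card → M₁) × (Fin b.card → M) ↦ smashCoord μ p.1 p.2 :=
  continuous_pi fun _ ↦ hμ.comp (((continuous_apply _).comp continuous_fst).prodMk
    ((continuous_apply _).comp continuous_snd))

theorem IsGeneric.smashCoord {x : Fin a.card → M₁} {y : Fin b.card → M} (hx : IsGeneric m₁ x)
    (hy : IsGeneric m₀ y) (hμ : IsCollapse ({m₁}ᶜ ×ˢ {m₀}ᶜ) m₀' μ) :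
    IsGeneric m₀' (smashCoord μ x y) := by
  refine hμ.isGeneric (fun p q h ↦ finSigmaFinEquiv.symm.injective ?_)
    fun q ↦ ⟨hx.ne_base _, hy.ne_base _⟩
  exact Sigma.ext (hx.injective (congrArg Prod.fst h))
    (heq_of_eq (hy.injective (congrArg Prod.snd h)))

theorem IsCollapse.exists_finset_subset_image_prod (hμ : IsCollapse ({m₁}ᶜ ×ˢ {m₀}ᶜ) m₀' μ)
    {W : Finset M'} (hW : m₀' ∉ W) :
    ∃ (W₁ : Finset M₁) (W₀ : Finset M), W₁.card ≤ W.card ∧ m₁ ∉ W₁ ∧ W₀.card ≤ W.card ∧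
      m₀ ∉ W₀ ∧ (W : Set M') ⊆ μ '' (W₁ ×ˢ W₀) := by
  classical
  obtain ⟨V, hV, card_V, image_V⟩ := hμ.exists_finset_image_eq hW
  refine ⟨V.image Prod.fst, V.image Prod.snd, Finset.card_image_le.trans_eq card_V, fun h ↦ ?_,
    Finset.card_image_le.trans_eq card_V, fun h ↦ ?_, ?_⟩
  · obtain ⟨p, hp, hp₁⟩ := Finset.mem_image.1 h
    exact (hV hp).1 hp₁
  · obtain ⟨p, hp, hp₀⟩ := Finset.mem_image.1 h
    exact (hV hp).2 hp₀
  · rw [← image_V]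
    exact Set.image_mono fun p hp ↦
      ⟨Finset.mem_image_of_mem _ hp, Finset.mem_image_of_mem _ hp⟩

end Smash

/-! ### Realisation of presheaves on a product of categories -/

section RealizeProd

variable {C₁ C : Type} [SmallCategory C₁] [SmallCategory C] {G₁ : C₁ ⥤ CGTop.{u}}
  {G : C ⥤ CGTop.{u}} {X : (C₁ × C)ᵒᵖ ⥤ Type}

/-- The point of the realisation of `X` given by an element of `X(c₁, c)` and a point of
`G₁(c₁) × G(c)`. -/
noncomputable def realizeProdMk (P : C₁ × C) (h : X.obj (op P)) (t : G₁.obj P.1) (s : G.obj P.2) :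
    (realizeSets (G₁.prod G ⋙ kProd)).obj X :=
  tensorMk (F := X ⋙ discreteSpace.{u}) (G := G₁.prod G ⋙ kProd) P
    ((kifyEquiv (TopCat.discrete.obj (ULift.{u} (X.obj (op P))))).symm (ULift.up h))
    ((kifyEquiv (.of (G₁.obj P.1 × G.obj P.2))).symm (t, s))

theorem exists_realizeProdMk_eq (x : (realizeSets (G₁.prod G ⋙ kProd)).obj X) :
    ∃ P h t s, realizeProdMk (X := X) (G₁ := G₁) (G := G) P h t s = x := by
  obtain ⟨P, h, p, rfl⟩ := exists_tensorMk_eq (F := X ⋙ discreteSpace.{u})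
    (G := G₁.prod G ⋙ kProd) x
  exact ⟨P, ULift.down h, p.1, p.2, rfl⟩

theorem realizeProdMk_glue {P P' : C₁ × C} (f : P ⟶ P') (h : X.obj (op P')) (t : G₁.obj P.1)
    (s : G.obj P.2) :
    realizeProdMk P (X.map f.op h) t s =
      realizeProdMk P' h ((G₁.map f.1).hom t) ((G.map f.2).hom s) :=
  tensorMk_glue (F := X ⋙ discreteSpace.{u}) (G := G₁.prod G ⋙ kProd) f _ _

/-- The map out of the realisation of `X` induced by a compatible family of maps. -/
noncomputable def realizeProdLift {Z : Type*}
    (g : ∀ P : C₁ × C, X.obj (op P) → G₁.obj P.1 → G.obj P.2 → Z)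
    (hg : ∀ {P P' : C₁ × C} (f : P ⟶ P') (h : X.obj (op P')) (t : G₁.obj P.1) (s : G.obj P.2),
      g P (X.map f.op h) t s = g P' h ((G₁.map f.1).hom t) ((G.map f.2).hom s)) :
    (realizeSets (G₁.prod G ⋙ kProd)).obj X → Z :=
  tensorLift (F := X ⋙ discreteSpace.{u}) (G := G₁.prod G ⋙ kProd)
    (fun P h p ↦ g P (ULift.down (kifyEquiv _ h)) (kifyEquiv _ p).1 (kifyEquiv _ p).2)
    fun f h p ↦ hg f (ULift.down (kifyEquiv _ h)) (kifyEquiv _ p).1 (kifyEquiv _ p).2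

theorem continuous_realizeProdMk {Z : Type*} [TopologicalSpace Z]
    [IsGeneratedBy compHausFamily.{u} Z] (P : C₁ × C) (h : X.obj (op P)) {a : Z → G₁.obj P.1}
    {b : Z → G.obj P.2} (ha : Continuous a) (hb : Continuous b) :
    Continuous fun z ↦ realizeProdMk P h (a z) (b z) :=
  continuous_tensorMk (F := X ⋙ discreteSpace.{u}) (G := G₁.prod G ⋙ kProd) P continuous_const
    (continuous_kifyEquiv_comp_iff (Y := .of (G₁.obj P.1 × G.obj P.2)).1 (ha.prodMk hb))

theorem continuous_of_continuous_realizeProdMk {Z : Type u} [TopologicalSpace Z]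
    {g : (realizeSets (G₁.prod G ⋙ kProd)).obj X → Z}
    (hg : ∀ P h, Continuous fun p : G₁.obj P.1 × G.obj P.2 ↦ g (realizeProdMk P h p.1 p.2)) :
    Continuous g := by
  refine (continuous_tensor_iff (F := X ⋙ discreteSpace.{u})
    (G := G₁.prod G ⋙ kProd)).2 fun P L φ ↦ ?_
  let a (y : compHausFamily.{u} L) : TopCat.discrete.obj (ULift.{u} (X.obj (op P))) :=
    kifyEquiv _ (φ y).1
  have continuous_a : Continuous a := (continuous_kifyEquiv _).comp φ.continuous.fst
  let b (y : compHausFamily.{u} L) : G₁.obj P.1 × G.obj P.2 := kifyEquiv (.of _) (φ y).2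
  have continuous_b : Continuous b := (continuous_kifyEquiv (.of _)).comp φ.continuous.snd
  have continuous_element_fixed :
      Continuous fun y : TopCat.discrete.obj (ULift.{u} (X.obj (op P))) × compHausFamily.{u} L ↦
        g (realizeProdMk P (ULift.down y.1) (b y.2).1 (b y.2).2) :=
    continuous_prod_of_discrete_left.2 fun h ↦ (hg P (ULift.down h)).comp continuous_b
  exact continuous_element_fixed.comp (continuous_a.prodMk continuous_id)

end RealizeProd

/-! ### Cells of wreath products -/

section WreathCells

variable {C : Type} [SmallCategory C]

/-- The cells of `Δ ≀ C` associated with cells `G(c)` of `C`: the cell of `T` is the realisation of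
`δ^*(Δ ≀ C)[T]`. -/
noncomputable abbrev wreathCell (G : C ⥤ CGTop.{u}) : Wreath segal C ⥤ CGTop.{u} :=
  yoneda (C := Wreath segal C) ⋙
    (Functor.whiskeringLeft (SimplexCategory × C)ᵒᵖ (Wreath segal C)ᵒᵖ Type).obj (diag C).op ⋙
      realizeSets (simplexSpace.prod G ⋙ kProd)

/-- The composite `Δ ≀ C → Γ ≀ Γ → Γ` of `γ ≀ γ_C` with the disjoint sum, for `γ_C : C → Γ`. -/
noncomputable abbrev wreathAssembly (γ : C ⥤ Gam) : Wreath segal C ⥤ Gam :=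
  Wreath.toGam segal C ⋙ Wreath.mapLabel (𝟭 Gam) γ ⋙ disjointSum

variable {G : C ⥤ CGTop.{u}} {γ : C ⥤ Gam} {T T' : Wreath segal C}

/-- The point of the cell of `T` given by an operator `δ([m], c) → T` and a point of
`Δ^m × G(c)`. -/
noncomputable def wreathCellMk (P : SimplexCategory × C) (h : (diag C).obj P ⟶ T)
    (t : simplexSpace.{u}.obj P.1) (s : G.obj P.2) : (wreathCell G).obj T :=
  realizeProdMk (X := (diag C).op ⋙ yoneda.obj T) P h t s

theorem exists_wreathCellMk_eq (x : (wreathCell G).obj T) :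
    ∃ P h t s, wreathCellMk (T := T) P h t s = x :=
  exists_realizeProdMk_eq (X := (diag C).op ⋙ yoneda.obj T) x

theorem wreathCell_map_wreathCellMk (g : T ⟶ T') {P : SimplexCategory × C}
    (h : (diag C).obj P ⟶ T) (t : simplexSpace.{u}.obj P.1) (s : G.obj P.2) :
    ((wreathCell G).map g).hom (wreathCellMk P h t s) = wreathCellMk P (h ≫ g) t s :=
  rfl

theorem wreathCell_map_diag_comp {P P' : SimplexCategory × C} (f : P ⟶ P')
    (h : (diag C).obj P' ⟶ T) (t : simplexSpace.{u}.obj P.1) (s : G.obj P.2) :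
    ((wreathCell G).map ((diag C).map f ≫ h)).hom (wreathCellMk P (𝟙 _) t s) =
      wreathCellMk P' h ((simplexSpace.map f.1).hom t) ((G.map f.2).hom s) := by
  rw [wreathCell_map_wreathCellMk, Category.id_comp]
  exact realizeProdMk_glue (X := (diag C).op ⋙ yoneda.obj T) f h t s

namespace CellCoords

variable {M₁ M M' : Type u} [TopologicalSpace M₁] [TopologicalSpace M] {m₁ : M₁} {m₀ : M}
  {m₀' : M'} {μ : M₁ × M → M'} (D₁ : CellCoords segal simplexSpace.{u} M₁ m₁)
  (D : CellCoords γ G M m₀)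

/-- The coordinates of a point of `Δ^m × G(c)`, regarded as a point of the cell of `δ([m], c)`: the
products of the coordinates of its two components. -/
def diagCoord (μ : M₁ × M → M') (P : SimplexCategory × C) (t : simplexSpace.{u}.obj P.1)
    (s : G.obj P.2) : Fin ((wreathAssembly γ).obj ((diag C).obj P)).card → M' :=
  smashCoord μ (D₁.coord P.1 t) (D.coord P.2 s)

theorem diagCoord_map (hμ : ∀ p, p ∉ {m₁}ᶜ ×ˢ {m₀}ᶜ → μ p = m₀') {P P' : SimplexCategory × C}
    (f : P ⟶ P') (t : simplexSpace.{u}.obj P.1) (s : G.obj P.2) :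
    D₁.diagCoord D μ P' ((simplexSpace.map f.1).hom t) ((G.map f.2).hom s) =
      powerMap m₀' ((wreathAssembly γ).map ((diag C).map f)) (D₁.diagCoord D μ P t s) := by
  rw [diagCoord, D₁.naturality, D.naturality]
  exact smashCoord_powerMap hμ (segal.map f.1) (γ.map f.2)
    ((wreathAssembly γ).map ((diag C).map f))
    (fun p q ↦ ⟨fun ⟨h, h'⟩ ↦ ⟨h, h'⟩, fun ⟨h, h'⟩ ↦ ⟨h, h'⟩⟩) _ _

/-- The coordinates of the cells of a wreath product, determined by `diagCoord` and naturality. -/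
noncomputable def wreathCoord (hμ : ∀ p, p ∉ {m₁}ᶜ ×ˢ {m₀}ᶜ → μ p = m₀') (T : Wreath segal C) :
    (wreathCell G).obj T → Fin ((wreathAssembly γ).obj T).card → M' :=
  realizeProdLift (X := (diag C).op ⋙ yoneda.obj T)
    (fun P (h : (diag C).obj P ⟶ T) t s ↦
      powerMap m₀' ((wreathAssembly γ).map h) (D₁.diagCoord D μ P t s)) (by
    intro P P' f (h : (diag C).obj P' ⟶ T) t s
    rw [D₁.diagCoord_map D hμ, ← powerMap_comp, ← (wreathAssembly γ).map_comp]
    rfl)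

theorem wreathCoord_wreathCellMk (hμ : ∀ p, p ∉ {m₁}ᶜ ×ˢ {m₀}ᶜ → μ p = m₀')
    (P : SimplexCategory × C) (h : (diag C).obj P ⟶ T) (t : simplexSpace.{u}.obj P.1)
    (s : G.obj P.2) : D₁.wreathCoord D hμ T (wreathCellMk P h t s) =
      powerMap m₀' ((wreathAssembly γ).map h) (D₁.diagCoord D μ P t s) :=
  rfl

theorem wreathCoord_map (hμ : ∀ p, p ∉ {m₁}ᶜ ×ˢ {m₀}ᶜ → μ p = m₀') (g : T ⟶ T')
    (x : (wreathCell G).obj T) : D₁.wreathCoord D hμ T' (((wreathCell G).map g).hom x) =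
      powerMap m₀' ((wreathAssembly γ).map g) (D₁.wreathCoord D hμ T x) := by
  obtain ⟨P, h, t, s, rfl⟩ := exists_wreathCellMk_eq x
  rw [wreathCell_map_wreathCellMk, wreathCoord_wreathCellMk, wreathCoord_wreathCellMk,
    (wreathAssembly γ).map_comp, powerMap_comp]

theorem wreathCoord_wreathCellMk_id (hμ : ∀ p, p ∉ {m₁}ᶜ ×ˢ {m₀}ᶜ → μ p = m₀')
    (P : SimplexCategory × C) (t : simplexSpace.{u}.obj P.1) (s : G.obj P.2) :
    D₁.wreathCoord D hμ _ (wreathCellMk P (𝟙 _) t s) = D₁.diagCoord D μ P t s := by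
  rw [wreathCoord_wreathCellMk, (wreathAssembly γ).map_id, powerMap_id]

variable [TopologicalSpace M']

theorem continuous_wreathCoord (hμ : ∀ p, p ∉ {m₁}ᶜ ×ˢ {m₀}ᶜ → μ p = m₀')
    (continuous_μ : Continuous μ) (T : Wreath segal C) : Continuous (D₁.wreathCoord D hμ T) :=
  continuous_of_continuous_realizeProdMk (X := (diag C).op ⋙ yoneda.obj T) fun P h ↦
    (continuous_powerMap m₀' ((wreathAssembly γ).map h)).comp <|
      (continuous_smashCoord continuous_μ).comp <|
        (D₁.continuous_coord P.1).prodMap (D.continuous_coord P.2)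

theorem exists_wreath_refinement (hμ : IsCollapse ({m₁}ᶜ ×ˢ {m₀}ᶜ) m₀' μ)
    (x : (wreathCell G).obj T) (x' : (wreathCell G).obj T') :
    ∃ (S : Wreath segal C) (s : (wreathCell G).obj S) (f : S ⟶ T) (f' : S ⟶ T'),
      ((wreathCell G).map f).hom s = x ∧ ((wreathCell G).map f').hom s = x' ∧
        IsGeneric m₀' (D₁.wreathCoord D hμ.eq_base S s) := by
  obtain ⟨P, h, t, s, rfl⟩ := exists_wreathCellMk_eq x
  obtain ⟨P', h', t', s', rfl⟩ := exists_wreathCellMk_eq x'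
  obtain ⟨X, t₀, φ, φ', rfl, rfl, generic_t₀⟩ := D₁.exists_refinement _ _ t t'
  obtain ⟨c, s₀, ψ, ψ', rfl, rfl, generic_s₀⟩ := D.exists_refinement _ _ s s'
  refine ⟨(diag C).obj (X, c), wreathCellMk (X, c) (𝟙 _) t₀ s₀,
    (diag C).map (Y := P) (φ, ψ) ≫ h, (diag C).map (Y := P') (φ', ψ') ≫ h',
    wreathCell_map_diag_comp (P := (X, c)) (P' := P) (φ, ψ) h t₀ s₀,
    wreathCell_map_diag_comp (P := (X, c)) (P' := P') (φ', ψ') h' t₀ s₀, ?_⟩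
  rw [wreathCoord_wreathCellMk_id]
  exact generic_t₀.smashCoord generic_s₀ hμ

theorem exists_wreath_cover (hμ : IsCollapse ({m₁}ᶜ ×ˢ {m₀}ᶜ) m₀' μ) (k : ℕ) :
    ∃ (T : Wreath segal C) (K : CompHaus.{u}) (κ : K.toTop → (wreathCell G).obj T),
      Continuous κ ∧ ∀ W : Finset M', W.card ≤ k → m₀' ∉ W →
        ∃ y, ↑W ⊆ Set.range (D₁.wreathCoord D hμ.eq_base T (κ y)) := by
  obtain ⟨X, K₁, κ₁, hκ₁, cover₁⟩ := D₁.exists_cover k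
  obtain ⟨c, K₀, κ₀, hκ₀, cover₀⟩ := D.exists_cover k
  refine ⟨(diag C).obj (X, c), CompHaus.of (K₁ × K₀),
    fun y ↦ wreathCellMk (X, c) (𝟙 _) (κ₁ y.1) (κ₀ y.2),
    continuous_realizeProdMk (Z := K₁ × K₀) (X := (diag C).op ⋙ yoneda.obj _) (X, c) (𝟙 _)
      (hκ₁.comp continuous_fst) (hκ₀.comp continuous_snd), fun W hW hm ↦ ?_⟩
  obtain ⟨W₁, W₀, card_W₁, hm₁, card_W₀, hm₀, hWμ⟩ := hμ.exists_finset_subset_image_prod hm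
  obtain ⟨y₁, hy₁⟩ := cover₁ W₁ (card_W₁.trans hW) hm₁
  obtain ⟨y₀, hy₀⟩ := cover₀ W₀ (card_W₀.trans hW) hm₀
  refine ⟨(y₁, y₀), fun w hw ↦ ?_⟩
  obtain ⟨⟨w₁, w₀⟩, ⟨hw₁, hw₀⟩, rfl⟩ := hWμ hw
  obtain ⟨i, rfl⟩ := hy₁ hw₁
  obtain ⟨r, rfl⟩ := hy₀ hw₀
  rw [wreathCoord_wreathCellMk_id]
  exact ⟨_, smashCoord_finSigmaFinEquiv _ _ i r⟩

/-- The coordinates of the cells of a wreath product in a smash product: `μ` exhibits `M'` as the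
smash product of `M₁` and `M`. -/
noncomputable def wreath (hμ : IsCollapse ({m₁}ᶜ ×ˢ {m₀}ᶜ) m₀' μ) :
    CellCoords (wreathAssembly γ) (wreathCell G) M' m₀' where
  coord := D₁.wreathCoord D hμ.eq_base
  continuous_coord := D₁.continuous_wreathCoord D hμ.eq_base hμ.continuous
  naturality := D₁.wreathCoord_map D hμ.eq_base
  exists_refinement _ _ := D₁.exists_wreath_refinement D hμ
  exists_cover := D₁.exists_wreath_cover D hμ

end CellCoords

end WreathCells

/-! ### Spheres -/

theorem isCollapse_extend {X S Y : Type*} [TopologicalSpace X] [T2Space X] [TopologicalSpace S]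
    [CompactSpace S] [TopologicalSpace Y] {j : Y → X} {i : Y → S} {s₀ : S}
    (hj : IsOpenEmbedding j) (hi : IsEmbedding i) (range_i : Set.range i = {s₀}ᶜ) :
    IsCollapse (Set.range j) s₀ (Function.extend j i fun _ ↦ s₀) := by
  set f := Function.extend j i fun _ ↦ s₀
  have f_apply (y : Y) : f (j y) = i y := hj.injective.extend_apply _ _ y
  have f_base {x : X} (hx : x ∉ Set.range j) : f x = s₀ := Function.extend_apply' _ _ x hx
  have preimage_eq {A : Set S} (hA : s₀ ∉ A) : f ⁻¹' A = j '' (i ⁻¹' A) := by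
    ext x
    by_cases hx : x ∈ Set.range j
    · obtain ⟨y, rfl⟩ := hx
      rw [hj.injective.mem_set_image, Set.mem_preimage, Set.mem_preimage, f_apply]
    · exact iff_of_false (fun h ↦ hA (f_base hx ▸ h)) fun h ↦ hx (Set.image_subset_range _ _ h)
  refine ⟨continuous_def.2 fun O hO ↦ ?_, ⟨?_, ?_, ?_⟩, fun x ↦ f_base⟩
  · by_cases hs : s₀ ∈ O
    · have hs' : s₀ ∉ Oᶜ := not_not_intro hs
      have isCompact_preimage : IsCompact (i ⁻¹' Oᶜ) := hi.isInducing.isCompact_preimage'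
        hO.isClosed_compl.isCompact (range_i ▸ Set.subset_compl_singleton_iff.2 hs')
      rw [← isClosed_compl_iff, ← Set.preimage_compl, preimage_eq hs']
      exact (isCompact_preimage.image hj.continuous).isClosed
    · rw [preimage_eq hs]
      exact hj.isOpenMap _ (hO.preimage hi.continuous)
  · rintro _ ⟨y, rfl⟩
    rw [f_apply, ← range_i]
    exact Set.mem_range_self y
  · rintro _ ⟨y, rfl⟩ _ ⟨y', rfl⟩ h
    rw [f_apply, f_apply] at h
    rw [hi.injective h]
  · rw [← range_i]
    rintro _ ⟨y, rfl⟩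
    exact ⟨j y, Set.mem_range_self y, f_apply y⟩

/-- The identification of `S^n` with the unit sphere of `ℝⁿ⁺¹`. -/
noncomputable def sphereHomeomorph (n : ℕ) :
    sphereSpace.{u} n ≃ₜ Metric.sphere (0 : EuclideanSpace ℝ (Fin (n + 1))) 1 :=
  (IsGeneratedBy.homeomorph (X := compHausFamily.{u})
    (Y := ULift.{u} (Metric.sphere (0 : EuclideanSpace ℝ (Fin (n + 1))) 1))).trans
      Homeomorph.ulift

instance (n : ℕ) : CompactSpace (sphereSpace.{u} n) := (sphereHomeomorph n).symm.compactSpace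

instance (n : ℕ) : T2Space (sphereSpace.{u} n) := (sphereHomeomorph n).symm.t2Space

theorem exists_isOpenEmbedding_range_eq_compl_sphereBase (n : ℕ) :
    ∃ i : EuclideanSpace ℝ (Fin n) → sphereSpace.{u} n,
      IsOpenEmbedding i ∧ Set.range i = {sphereBase n}ᶜ := by
  have : Fact (Module.finrank ℝ (EuclideanSpace ℝ (Fin (n + 1))) = n + 1) := ⟨by simp⟩
  let projection := stereographic' n (sphereHomeomorph.{u} n (sphereBase n))
  have isOpenEmbedding_symm : IsOpenEmbedding projection.symm :=
    projection.symm.isOpenEmbedding (stereographic'_target _)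
  have range_symm : Set.range projection.symm = {sphereHomeomorph n (sphereBase n)}ᶜ := by
    have image_eq := projection.symm.image_source_eq_target
    rwa [projection.symm_source, projection.symm_target, stereographic'_target,
      stereographic'_source, Set.image_univ] at image_eq
  refine ⟨(sphereHomeomorph n).symm ∘ projection.symm,
    (sphereHomeomorph n).symm.isOpenEmbedding.comp isOpenEmbedding_symm, ?_⟩
  rw [Set.range_comp, range_symm, Set.image_compl_eq (Homeomorph.bijective _),
    Set.image_singleton, Homeomorph.symm_apply_apply]

theorem exists_isCollapse_unitInterval : ∃ e : unitInterval → sphereSpace.{u} 1,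
    IsCollapse (Set.Ioo 0 1) (sphereBase 1) e := by
  obtain ⟨i, hi, range_i⟩ := exists_isOpenEmbedding_range_eq_compl_sphereBase.{u} 1
  let line : ℝ ≃ₜ EuclideanSpace ℝ (Fin 1) := (Homeomorph.funUnique (Fin 1) ℝ).symm.trans
    (EuclideanSpace.equiv (Fin 1) ℝ).symm.toHomeomorph
  rw [← unitInterval.range_sigmoid]
  refine ⟨_, isCollapse_extend ⟨isEmbedding_sigmoid, ?_⟩
    (hi.isEmbedding.comp line.isEmbedding) ?_⟩
  · rw [unitInterval.range_sigmoid]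
    exact isOpen_Ioo
  · rw [line.surjective.range_comp, range_i]

theorem exists_isCollapse_sphere_prod (m n : ℕ) :
    ∃ μ : sphereSpace.{u} m × sphereSpace.{u} n → sphereSpace.{u} (n + m),
      IsCollapse ({sphereBase m}ᶜ ×ˢ {sphereBase n}ᶜ) (sphereBase (n + m)) μ := by
  obtain ⟨i₁, hi₁, range_i₁⟩ := exists_isOpenEmbedding_range_eq_compl_sphereBase.{u} m
  obtain ⟨i₂, hi₂, range_i₂⟩ := exists_isOpenEmbedding_range_eq_compl_sphereBase.{u} n
  obtain ⟨i, hi, range_i⟩ := exists_isOpenEmbedding_range_eq_compl_sphereBase.{u} (n + m)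
  let sum : EuclideanSpace ℝ (Fin m) × EuclideanSpace ℝ (Fin n) ≃ₜ
      EuclideanSpace ℝ (Fin (n + m)) :=
    (Homeomorph.prodComm _ _).trans EuclideanSpace.finAddEquivProd.symm.toHomeomorph
  rw [← range_i₁, ← range_i₂, ← Set.range_prodMap]
  refine ⟨_, isCollapse_extend (hi₁.prodMap hi₂) (hi.isEmbedding.comp sum.isEmbedding) ?_⟩
  rw [sum.surjective.range_comp, range_i]

theorem nonempty_cellCoords_assembly (n : ℕ) : Nonempty (CellCoords (assembly (n + 1))
    (thetaCell.{u} (n + 1)) (sphereSpace.{u} (n + 1)) (sphereBase (n + 1))) := by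
  obtain ⟨e, he⟩ := exists_isCollapse_unitInterval.{u}
  induction n with
  | zero => exact ⟨he.simplexCoords⟩
  | succ n ih =>
    obtain ⟨D⟩ := ih
    obtain ⟨μ, hμ⟩ := exists_isCollapse_sphere_prod.{u} 1 (n + 1)
    exact ⟨he.simplexCoords.wreath D hμ⟩

end ThetaSpaces

theorem mainTheorem6_general (n : ℕ) (hn : 1 ≤ n) :
    Nonempty ((Functor.whiskeringLeft _ _ ThetaSpaces.CGTop.{u}).obj (ThetaSpaces.assembly n).op ⋙
        ThetaSpaces.thetaRealization n ≅
      ThetaSpaces.tensor (ThetaSpaces.power (ThetaSpaces.sphereSpace n)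
        (ThetaSpaces.sphereBase n))) := by
  obtain ⟨n, rfl⟩ := Nat.exists_eq_add_of_le' hn
  obtain ⟨D⟩ := ThetaSpaces.nonempty_cellCoords_assembly.{u} n
  exact ⟨D.tensorIso⟩

theorem mainTheorem6 (n : ℕ) (hn : 1 ≤ n) :
    ∃ h : ∀ A : ThetaSpaces.GammaSpace.{u},
        ((ThetaSpaces.thetaRealization.{u} n).obj ((ThetaSpaces.assemblyPullback n).obj A)) ≃ₜ
          ((ThetaSpaces.segalSpectrumSpace.{u} n).obj A),
      ∀ (A B : ThetaSpaces.GammaSpace.{u}) (f : A ⟶ B)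
        (x : (ThetaSpaces.thetaRealization.{u} n).obj ((ThetaSpaces.assemblyPullback n).obj A)),
        h B (((ThetaSpaces.thetaRealization.{u} n).map
            ((ThetaSpaces.assemblyPullback n).map f)).hom x) =
          ((ThetaSpaces.segalSpectrumSpace.{u} n).map f).hom (h A x) := by
  obtain ⟨e⟩ := mainTheorem6_general.{u} n hn
  exact ⟨fun A ↦ TopCat.homeoOfIso ((ObjectProperty.ι _).mapIso (e.app A.obj)),
    fun A B f x ↦ ConcreteCategory.congr_hom (e.hom.naturality f.hom) x⟩
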